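/- Let $m\ge 1$, let $\mathcal C\subset\mathbb R^p$ be a Borel set and let $\mathfrak m$ be a Borel probability measure on $\mathcal C$ (the law of a random parameter $C$). Let $\mathfrak z:\mathcal C\to\mathbb R^m$ and $\mathcal L:\mathcal C\to\mathbb R^{m\times m}$ be measurable, where each $\mathcal L(c)$ is lower triangular with positive diagonal, and suppose $\|\mathfrak z(c)\|+\|\mathcal L(c)\|\le\eta_0$ for all $c\in\mathcal C$ and some $\eta_0>0$. Put $\Sigma(c)=\mathcal L(c)\mathcal L(c)^{\top}$ (so $\mathcal L(c)$ is the Cholesky factor of $\Sigma(c)$) and let $h_c$ be the density of $\mathcal N(\mathfrak z(c),\Sigma(c))$, the conditional law of a random vector $\xi$ given $C=c$. Let $g:\mathbb R^n\times\mathbb R^m\to\mathbb R$ be continuously differentiable and convex in its second argument, and define $$\varphi_c(x)=\int_{\{z:\,g(x,z)\le 0\}}h_c(z)\,dz,\qquad \Phi(x)=\int_{\mathcal C}\varphi_c(x)\,d\mathfrak m(c),$$ $$e_c(x,v)=\int_{\{r\ge 0:\ g(x,\,r\mathcal L(c)v+\mathfrak z(c))\le 0\}}\chi(r)\,dr\qquad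 (x\in\mathbb R^n,\ v\in\mathbb S^{m-1}),$$ where $\chi(r)=\frac{2^{1-m/2}}{\Gamma(m/2)}\,r^{m-1}e^{-r^2/2}$ is the density of the $\chi$-distribution with $m$ degrees of freedom. Let $X\subset\mathbb R^n$ be a compact set such that every $\bar x\in X$ satisfies the following two conditions. 1. (Uniform Slater condition) There are an open neighbourhood $U$ of $\bar x$ and $\gamma_0>0$ with $g(x,\mathfrak z(c))<-\gamma_0$ for all $x\in U$ and $c\in\mathcal C$. 2. (Exponential growth) There are $\varepsilon,a,b>0$ with $\|\nabla_x g(x,z)\|\le a\,e^{b\|z\|}$ for all $x\in\mathbb B_\varepsilon(\bar x)$ and $z\in\mathbb R^m$. Let $\zeta_\Theta$ be the uniform distribution on $\mathbb S^{m-1}$ and let $\{(v_i,c_i)\}_{i\ge 1}$ be random elements of $\mathbb S^{m-1}\times\mathcal C$ that either are i.i.d. with law $\pi:=\zeta_\Theta\otimes\mathfrak m$, or are produced by a Markov chain Monte Carlo method for $\pi$, i.e. form a time-homogeneous Markov chain with an arbitrary initial law whose transition kernel leaves $\pi$ invariant and is Harris recurrent with respect to $\pi$ (from every starting point the chain almost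 surely visits every measurable set of positive $\pi$-measure infinitely often). Then, for every $x\in X$, the functions $\Phi$ and $e_c(\cdot,v)$ (for all $c\in\mathcal C$ and $v\in\mathbb S^{m-1}$) are differentiable at $x$, and $$\Phi_N(x):=\frac1N\sum_{i=1}^N e_{c_i}(x,v_i)\ \longrightarrow\ \Phi(x)\quad\text{and}\quad \nabla\Phi_N(x):=\frac1N\sum_{i=1}^N\nabla_x e_{c_i}(x,v_i)\ \longrightarrow\ \nabla\Phi(x)$$ in probability as $N\to\infty$. -/

import Mathlib

open MeasureTheory ProbabilityTheory Filter Topology Gradient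
open scoped Matrix

noncomputable section

/-- The Euclidean space `ℝ^d`. -/
abbrev Eucl (d : ℕ) : Type := EuclideanSpace ℝ (Fin d)

/-- The unit sphere of `ℝ^m`. -/
abbrev USphere (m : ℕ) : Type := Metric.sphere (0 : Eucl m) 1

/-- The uniform probability distribution on the unit sphere of `ℝ^m` (for `m ≥ 1`): the surface
measure divided by its total mass. -/
def uniformSphere (m : ℕ) : Measure (USphere m) :=
  ((volume : Measure (Eucl m)).toSphere Set.univ)⁻¹ • (volume : Measure (Eucl m)).toSphere

/-- The density on `[0, ∞)` of the `χ`-distribution with `m` degrees of freedom. -/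
def chiDensity (m : ℕ) (r : ℝ) : ℝ :=
  (2 : ℝ) ^ (1 - (m : ℝ) / 2) / Real.Gamma ((m : ℝ) / 2) * r ^ (m - 1) * Real.exp (-r ^ 2 / 2)

/-- A Gaussian mixture model on `ℝ^m` with parameters in a Borel set of `ℝ^p`: the law `prior` of
the parameter, and for each parameter `c` the mean and the Cholesky factor of the covariance matrix
(lower triangular, positive diagonal) of the Gaussian law of `ξ` given `C = c`; these depend
measurably on `c` and are uniformly bounded. -/
structure GaussianMixture (m p : ℕ) where
  /-- the parameter space -/
  params : Set (Eucl p)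
  measurableSet_params : MeasurableSet params
  /-- the law of the parameter -/
  prior : Measure params
  isProbabilityMeasure_prior : IsProbabilityMeasure prior
  /-- the conditional mean -/
  mean : params → Eucl m
  measurable_mean : Measurable mean
  /-- the Cholesky factor of the conditional covariance matrix -/
  chol : params → Matrix (Fin m) (Fin m) ℝ
  measurable_chol : ∀ i j, Measurable fun c => chol c i j
  chol_lower : ∀ c i j, i < j → chol c i j = 0
  chol_diag_pos : ∀ c i, 0 < chol c i i
  bounded : ∃ η₀ : ℝ, 0 < η₀ ∧
    ∀ c, ‖mean c‖ + ‖Matrix.toEuclideanCLM (n := Fin m) (𝕜 := ℝ) (chol c)‖ ≤ η₀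

namespace GaussianMixture

variable {m p n : ℕ}

/-- The conditional covariance matrix, `Σ(c) = L(c) L(c)ᵀ`. -/
def cov (G : GaussianMixture m p) (c : G.params) : Matrix (Fin m) (Fin m) ℝ :=
  G.chol c * (G.chol c)ᵀ

/-- The density `h_c` of the Gaussian law with mean `mean c` and covariance `cov c`, which is the
conditional law of `ξ` given `C = c`. -/
def density (G : GaussianMixture m p) (c : G.params) (z : Eucl m) : ℝ :=
  1 / Real.sqrt ((2 * Real.pi) ^ m * (G.cov c).det) *
    Real.exp (-(1 / 2) *
      ((z - G.mean c).ofLp ⬝ᵥ ((G.cov c)⁻¹ *ᵥ (z - G.mean c).ofLp)))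

/-- The conditional probability function `φ_c(x) = P(g(x, ξ) ≤ 0 | C = c)`. -/
def condProb (G : GaussianMixture m p) (g : Eucl n → Eucl m → ℝ) (c : G.params) (x : Eucl n) : ℝ :=
  ∫ z in {z | g x z ≤ 0}, G.density c z

/-- The probability function `Φ(x) = E[φ_C(x)]`. -/
def probFun (G : GaussianMixture m p) (g : Eucl n → Eucl m → ℝ) (x : Eucl n) : ℝ :=
  ∫ c, G.condProb g c x ∂G.prior

/-- The radial probability function `e_c(x, v)`. -/
def radialProb (G : GaussianMixture m p) (g : Eucl n → Eucl m → ℝ) (c : G.params) (x : Eucl n)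
    (v : USphere m) : ℝ :=
  ∫ r in {r : ℝ | 0 ≤ r ∧
      g x (r • Matrix.toEuclideanCLM (n := Fin m) (𝕜 := ℝ) (G.chol c) v + G.mean c) ≤ 0},
    chiDensity m r

/-- `x₀` is a uniform Slater point for `g` along the conditional means. -/
def IsUniformSlaterPoint (G : GaussianMixture m p) (g : Eucl n → Eucl m → ℝ) (x₀ : Eucl n) :
    Prop :=
  ∃ U : Set (Eucl n), IsOpen U ∧ x₀ ∈ U ∧ ∃ γ₀ : ℝ, 0 < γ₀ ∧
    ∀ x ∈ U, ∀ c : G.params, g x (G.mean c) < -γ₀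

/-- The law on (direction, parameter) pairs from which the sample is drawn: the product of the
uniform law on the sphere and the law of the parameter. -/
def samplingLaw (G : GaussianMixture m p) : Measure (USphere m × G.params) :=
  (uniformSphere m).prod G.prior

/-- The empirical approximation of `Φ(x)` from the first `N` points `(v_i, c_i)` of a sequence. -/
def empProb (G : GaussianMixture m p) (g : Eucl n → Eucl m → ℝ)
    (s : ℕ → USphere m × G.params) (N : ℕ) (x : Eucl n) : ℝ :=
  (N : ℝ)⁻¹ * ∑ i ∈ Finset.range N, G.radialProb g (s i).2 x (s i).1

/-- The empirical approximation of `∇Φ(x)` from the first `N` points `(v_i, c_i)` of a sequence: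
the average of the gradients of `e_{c_i}(·, v_i)` at `x`. -/
def empGrad (G : GaussianMixture m p) (g : Eucl n → Eucl m → ℝ)
    (s : ℕ → USphere m × G.params) (N : ℕ) (x : Eucl n) : Eucl n :=
  (N : ℝ)⁻¹ • ∑ i ∈ Finset.range N, ∇ (fun y => G.radialProb g (s i).2 y (s i).1) x

end GaussianMixture

/-- The exponential growth condition for `∇ₓ g` at `x₀`. -/
def ExponentialGrowthAt {n m : ℕ} (g : Eucl n → Eucl m → ℝ) (x₀ : Eucl n) : Prop :=
  ∃ ε a b : ℝ, 0 < ε ∧ 0 < a ∧ 0 < b ∧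
    ∀ x ∈ Metric.ball x₀ ε, ∀ z, ‖∇ (fun y => g y z) x‖ ≤ a * Real.exp (b * ‖z‖)

section Sampling

variable {Ω S : Type*} [MeasurableSpace Ω] [MeasurableSpace S]

/-- The law on trajectories of the time-homogeneous Markov chain with transition kernel `κ` and
initial law `ν`. -/
def chainLaw (κ : Kernel S S) [IsMarkovKernel κ] (ν : Measure S) : Measure (ℕ → S) :=
  Kernel.trajMeasure (X := fun _ : ℕ => S) ν fun n =>
    κ.comap (fun h : (i : Finset.Iic n) → S => h ⟨n, Finset.mem_Iic.2 le_rfl⟩)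
      (measurable_pi_apply _)

/-- Harris recurrence with respect to `π`: from every starting point the chain almost surely visits
every set of positive `π`-measure infinitely often (in particular the chain is `π`-irreducible). -/
def IsHarrisRecurrent (κ : Kernel S S) [IsMarkovKernel κ] (π : Measure S) : Prop :=
  ∀ A : Set S, MeasurableSet A → 0 < π A →
    ∀ x : S, ∀ᵐ w ∂chainLaw κ (Measure.dirac x), ∃ᶠ k in atTop, w k ∈ A

/-- `Y` is an i.i.d. sequence with common law `π`. -/
structure IsIIDSample (P : Measure Ω) (Y : ℕ → Ω → S) (π : Measure S) : Prop where
  measurable : ∀ i, Measurable (Y i)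
  indep : iIndepFun Y P
  law : ∀ i, P.map (Y i) = π

/-- `Y` is produced by a Markov chain Monte Carlo method for `π`: it is a time-homogeneous Markov
chain, with any initial law, whose transition kernel leaves `π` invariant and is Harris recurrent
with respect to `π`. -/
structure IsMCMCSample (P : Measure Ω) (Y : ℕ → Ω → S) (π : Measure S) : Prop where
  measurable : ∀ i, Measurable (Y i)
  chain : ∃ (κ : Kernel S S) (_ : IsMarkovKernel κ), κ.Invariant π ∧ IsHarrisRecurrent κ π ∧
    P.map (fun ω i => Y i ω) = chainLaw κ (P.map (Y 0))

end Sampling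

end

/-! Given `C = c`, the vector `ξ` is the mean plus a χ-distributed radius times the Cholesky image
of a uniform direction. Hence `Φ(x)` is the integral of the radial function against `samplingLaw`
(`probFun_eq_integral`), and everything reduces to two facts: the radial functions have gradients at
`x` bounded uniformly in direction and parameter, and bounded functions of the sample obey a law of
large numbers.

Regularity. Along a ray `g` is convex in the radius and at most `-γ` at radius `0`, so the feasible
radii form either an interval `[0, ρ]` or the whole half-line. In the first case convexity makes the
slope at `ρ` positive and the implicit function theorem applies. In the second, moving `x` by `h`
only removes radii where the perturbation, of size `‖h‖ e^{Kr}`, exceeds `γ`; their mass is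
`O(‖h‖²)`, so the derivative is `0`. The Lipschitz bound is uniform because the Gaussian decay of
`χ` absorbs `e^{Kρ}` however far away the root `ρ` is (`setIntegral_chiDensity_le`). It bounds the
gradients and justifies differentiation under the integral.

Sampling. The i.i.d. case is the strong law. For a stationary chain the von Neumann mean ergodic
theorem, applied to the Markov operator on `L²(π)`, makes averaged correlations vanish; recurrence
enters because it forces fixed functions to be constant. From an arbitrary initial law, the chain
almost surely hits a set of full `π`-measure on which all its marginals are absolutely continuous,
and the law restarted there is dominated by the stationary one. -/

noncomputable section

/-! ### Markov laws on trajectory space and their uniqueness. -/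

section MarkovLaw

open scoped ENNReal

variable {S : Type*} [MeasurableSpace S]

/-- A measure on trajectories under which the coordinate process is a Markov chain with transition
kernel `κ`. -/
def IsMarkovLaw (κ : Kernel S S) (Q : Measure (ℕ → S)) : Prop :=
  ∀ (n : ℕ) (F : (ℕ → S) → ℝ≥0∞) (h : S → ℝ≥0∞), Measurable F → DependsOn F (Set.Iic n) →
    Measurable h → ∫⁻ w, F w * h (w (n + 1)) ∂Q = ∫⁻ w, F w * ∫⁻ y, h y ∂κ (w n) ∂Q

/-- The shift of a trajectory by `k` steps. -/
def trajShift (k : ℕ) (w : ℕ → S) : ℕ → S := fun i => w (k + i)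

@[fun_prop]
lemma measurable_trajShift (k : ℕ) : Measurable (trajShift (S := S) k) :=
  measurable_pi_lambda _ fun _ => measurable_pi_apply _

namespace IsMarkovLaw

variable {κ : Kernel S S} {Q Q' : Measure (ℕ → S)}

/-- A weight known at time `k` can be absorbed into the test function `F`, so the Markov property
survives from time `k` on. -/
lemma withDensity (hQ : IsMarkovLaw κ Q) {k : ℕ} {D : (ℕ → S) → ℝ≥0∞} (hD : Measurable D)
    (hdep : DependsOn D (Set.Iic k)) {n : ℕ} (hkn : k ≤ n) {F : (ℕ → S) → ℝ≥0∞} {h : S → ℝ≥0∞}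
    (hF : Measurable F) (hFd : DependsOn F (Set.Iic n)) (hh : Measurable h) :
    ∫⁻ w, F w * h (w (n + 1)) ∂Q.withDensity D =
      ∫⁻ w, F w * ∫⁻ y, h y ∂κ (w n) ∂Q.withDensity D := by
  have hκ : Measurable fun x => ∫⁻ y, h y ∂κ x := hh.lintegral_kernel
  rw [lintegral_withDensity_eq_lintegral_mul _ hD (by fun_prop),
    lintegral_withDensity_eq_lintegral_mul _ hD (by fun_prop)]
  simp only [Pi.mul_apply, ← mul_assoc]
  refine hQ n (fun w => D w * F w) h (hD.mul hF) (fun x y hxy => ?_) hh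
  have h1 : D x = D y := hdep fun i hi => hxy i (le_trans (Set.mem_Iic.1 hi) hkn)
  simp only [h1, hFd hxy]

/-- With `D` the indicator of an event at time `k`, this restarts the chain on that event. The
result need not have mass `1`, which is why Markov laws are not required to be probability measures.
-/
lemma map_shift (hQ : IsMarkovLaw κ Q) {k : ℕ} {D : (ℕ → S) → ℝ≥0∞} (hD : Measurable D)
    (hdep : DependsOn D (Set.Iic k)) :
    IsMarkovLaw κ ((Q.withDensity D).map (trajShift k)) := by
  intro n F h hF hFd hh
  have hκ : Measurable fun x => ∫⁻ y, h y ∂κ x := hh.lintegral_kernel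
  rw [lintegral_map (by fun_prop) (by fun_prop), lintegral_map (by fun_prop) (by fun_prop)]
  exact hQ.withDensity hD hdep (Nat.le_add_right k n) (F := fun w => F (trajShift k w))
    (by fun_prop) (fun x y hxy => hFd fun i hi => hxy _ (by simp at hi ⊢; omega)) hh

lemma lintegral_prod_eq (hQ : IsMarkovLaw κ Q) (hQ' : IsMarkovLaw κ Q')
    (h0 : Q.map (fun w => w 0) = Q'.map (fun w => w 0)) {A : ℕ → Set S}
    (hA : ∀ i, MeasurableSet (A i)) (n : ℕ) {h : S → ℝ≥0∞} (hh : Measurable h) :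
    ∫⁻ w, (∏ i ∈ Finset.range n, (A i).indicator 1 (w i)) * h (w n) ∂Q =
      ∫⁻ w, (∏ i ∈ Finset.range n, (A i).indicator 1 (w i)) * h (w n) ∂Q' := by
  induction n generalizing h with
  | zero =>
    simp only [Finset.range_zero, Finset.prod_empty, one_mul]
    rw [← lintegral_map (g := fun w : ℕ → S => w 0) hh (by fun_prop), h0,
      lintegral_map hh (by fun_prop)]
  | succ n ih =>
    have hm : ∀ i, Measurable ((A i).indicator (1 : S → ℝ≥0∞)) :=
      fun i => measurable_one.indicator (hA i)
    have hF : Measurable fun w : ℕ → S =>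
        ∏ i ∈ Finset.range (n + 1), (A i).indicator (1 : S → ℝ≥0∞) (w i) := by
      refine Finset.measurable_prod _ fun i _ => (hm i).comp (measurable_pi_apply i)
    have hFd : DependsOn (fun w : ℕ → S =>
        ∏ i ∈ Finset.range (n + 1), (A i).indicator (1 : S → ℝ≥0∞) (w i)) (Set.Iic n) :=
      fun x y hxy => Finset.prod_congr rfl fun i hi => by
        rw [hxy i (by simpa [Nat.lt_succ_iff] using hi)]
    rw [hQ n _ h hF hFd hh, hQ' n _ h hF hFd hh]
    simp only [Finset.prod_range_succ, mul_assoc]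
    -- The last indicator and the kernel integral together form the new `h`, now evaluated at time
    -- `n`.
    exact ih ((hm n).mul hh.lintegral_kernel)

lemma ext [IsFiniteMeasure Q] [IsFiniteMeasure Q'] (hQ : IsMarkovLaw κ Q)
    (hQ' : IsMarkovLaw κ Q') (h0 : Q.map (fun w => w 0) = Q'.map (fun w => w 0)) : Q = Q' := by
  classical
  have key : ∀ (A : ℕ → Set S), (∀ i, MeasurableSet (A i)) → ∀ n : ℕ,
      Q {w | ∀ i < n, w i ∈ A i} = Q' {w | ∀ i < n, w i ∈ A i} := by
    intro A hA n
    have h := lintegral_prod_eq hQ hQ' h0 hA n (h := fun _ => 1) measurable_const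
    have hm : MeasurableSet {w : ℕ → S | ∀ i < n, w i ∈ A i} := by
      have : {w : ℕ → S | ∀ i < n, w i ∈ A i} = ⋂ i, ⋂ (_ : i < n), (fun w => w i) ⁻¹' A i := by
        ext; simp
      rw [this]
      exact MeasurableSet.iInter fun i => MeasurableSet.iInter fun _ =>
        measurable_pi_apply i (hA i)
    have e : ∀ w : ℕ → S, (∏ i ∈ Finset.range n, (A i).indicator (1 : S → ℝ≥0∞) (w i)) * 1 =
        {w : ℕ → S | ∀ i < n, w i ∈ A i}.indicator 1 w := by
      intro w
      by_cases hw : ∀ i < n, w i ∈ A i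
      · rw [Set.indicator_of_mem (by exact hw), mul_one, Finset.prod_eq_one]; · rfl
        intro i hi
        rw [Set.indicator_of_mem (hw i (Finset.mem_range.1 hi))]; rfl
      · rw [Set.indicator_of_notMem (by exact hw), mul_one]
        push Not at hw
        obtain ⟨i, hi, hiA⟩ := hw
        exact Finset.prod_eq_zero (Finset.mem_range.2 hi) (Set.indicator_of_notMem hiA _)
    simp only [e] at h
    rwa [lintegral_indicator_one hm, lintegral_indicator_one hm] at h
  refine ext_of_generate_finite _ generateFrom_squareCylinders.symm
    (isPiSystem_squareCylinders (fun _ => MeasurableSpace.isPiSystem_measurableSet)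
      fun _ => MeasurableSet.univ) ?_ ?_
  · rintro _ ⟨s, t, ht, rfl⟩
    -- A cylinder over `s` constrains only times below `s.sup id + 1`; the other times get the
    -- trivial constraint.
    have := key (fun i => if i ∈ s then t i else Set.univ) (fun i => by
      split_ifs with hi
      · exact ht i (Set.mem_univ i)
      · exact MeasurableSet.univ) (s.sup id + 1)
    convert this using 2 <;>
    · ext w
      simp only [Set.mem_pi, Set.mem_ofPred_eq, Finset.mem_coe]
      constructor
      · intro h i _
        split_ifs with hi
        · exact h i hi
        · trivial
      · intro h i hi
        have := h i (Nat.lt_succ_of_le (Finset.le_sup (f := id) hi))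
        rwa [if_pos hi] at this
  -- With no constraint at all, `key` compares the total masses.
  · simpa using key (fun _ => Set.univ) (fun _ => MeasurableSet.univ) 0

end IsMarkovLaw

lemma isMarkovLaw_chainLaw (κ : Kernel S S) [IsMarkovKernel κ] (ν : Measure S)
    [IsProbabilityMeasure ν] : IsMarkovLaw κ (chainLaw κ ν) := by
  intro n F h hF hFd hh
  -- Freezing the history after time `n` turns `F` into a measurable function of the finite history.
  let ex : ((i : Finset.Iic n) → S) → ℕ → S :=
    fun x j => x ⟨min j n, Finset.mem_Iic.2 (min_le_right _ _)⟩
  have hex : Measurable ex := measurable_pi_lambda _ fun j => measurable_pi_apply _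
  have hFe : ∀ w : ℕ → S, F w = F (ex (Preorder.frestrictLe n w)) := fun w => hFd fun i hi => by
    simp [ex, Preorder.frestrictLe, min_eq_left (Set.mem_Iic.1 hi)]
  have hκ : Measurable fun x => ∫⁻ y, h y ∂κ x := hh.lintegral_kernel
  let κ' : (n : ℕ) → Kernel ((i : Finset.Iic n) → S) S := fun n =>
    κ.comap (fun h : (i : Finset.Iic n) → S => h ⟨n, Finset.mem_Iic.2 le_rfl⟩)
      (measurable_pi_apply _)
  have hc := Kernel.map_frestrictLe_trajMeasure_compProd_eq_map_trajMeasure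
    (X := fun _ : ℕ => S) (μ₀ := ν) (κ := κ') (a := n)
  have hm : Measurable fun q : ((i : Finset.Iic n) → S) × S => F (ex q.1) * h q.2 := by fun_prop
  have h1 := congrArg (fun M => ∫⁻ q, F (ex q.1) * h q.2 ∂M) hc
  rw [Measure.lintegral_compProd hm, lintegral_map hm (by fun_prop),
    lintegral_map (by fun_prop) (by fun_prop)] at h1
  have e : chainLaw κ ν = Kernel.trajMeasure (X := fun _ : ℕ => S) ν κ' := rfl
  rw [e]
  calc ∫⁻ w, F w * h (w (n + 1)) ∂Kernel.trajMeasure (X := fun _ : ℕ => S) ν κ'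
      = ∫⁻ w, F (ex (Preorder.frestrictLe n w)) * h (w (n + 1))
          ∂Kernel.trajMeasure (X := fun _ : ℕ => S) ν κ' := lintegral_congr fun w => by rw [← hFe w]
    _ = _ := h1.symm
    _ = _ := lintegral_congr fun w => by
      rw [hFe w]
      exact lintegral_const_mul (μ := κ (w n)) (F (ex (Preorder.frestrictLe n w))) hh

instance (κ : Kernel S S) [IsMarkovKernel κ] (ν : Measure S) [IsProbabilityMeasure ν] :
    IsProbabilityMeasure (chainLaw κ ν) := by
  unfold chainLaw; infer_instance

lemma chainLaw_apply (κ : Kernel S S) [IsMarkovKernel κ] (ν : Measure S) {E : Set (ℕ → S)}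
    (hE : MeasurableSet E) :
    chainLaw κ ν E = ∫⁻ x, chainLaw κ (Measure.dirac x) E ∂ν := by
  unfold chainLaw Kernel.trajMeasure
  rw [Measure.bind_apply hE (by fun_prop), lintegral_map (Kernel.measurable_coe _ hE) (by fun_prop)]
  refine lintegral_congr fun x => ?_
  rw [Measure.bind_apply hE (by fun_prop), lintegral_map (Kernel.measurable_coe _ hE) (by fun_prop),
    lintegral_dirac' (α := S) x]
  exact (Kernel.measurable_coe _ hE).comp (by fun_prop)

lemma chainLaw_map_zero (κ : Kernel S S) [IsMarkovKernel κ] (ν : Measure S)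
    [IsProbabilityMeasure ν] : (chainLaw κ ν).map (fun w => w 0) = ν := by
  let κ' : (n : ℕ) → Kernel ((i : Finset.Iic n) → S) S := fun n =>
    κ.comap (fun h : (i : Finset.Iic n) → S => h ⟨n, Finset.mem_Iic.2 le_rfl⟩)
      (measurable_pi_apply _)
  have h : (chainLaw κ ν).map (Preorder.frestrictLe 0) =
      ν.map (MeasurableEquiv.piUnique fun _ : Finset.Iic 0 => S).symm := by
    change (Kernel.traj (X := fun _ : ℕ => S) κ' 0 ∘ₘ _).map _ = _
    rw [Measure.map_comp _ _ (by fun_prop), Kernel.traj_map_frestrictLe, Kernel.partialTraj_self,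
      Measure.id_comp]
  have h2 := congrArg (Measure.map fun x => x ⟨0, Finset.mem_Iic.2 le_rfl⟩) h
  rw [Measure.map_map (by fun_prop) (by fun_prop), Measure.map_map (by fun_prop) (by fun_prop)]
    at h2
  refine h2.trans ?_
  exact Measure.map_id

end MarkovLaw

/-! ### The mean ergodic theorem for the stationary chain. -/

section Stationary

open scoped ENNReal InnerProductSpace

variable {S : Type*} [MeasurableSpace S]

namespace IsMarkovLaw

variable {κ : Kernel S S} {Q : Measure (ℕ → S)} {π : Measure S}

lemma measurePreserving_eval (hQ : IsMarkovLaw κ Q) (hκ : κ.Invariant π)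
    (h0 : Q.map (fun w => w 0) = π) (n : ℕ) : MeasurePreserving (fun w : ℕ → S => w n) Q π := by
  refine ⟨measurable_pi_apply n, ?_⟩
  induction n with
  | zero => exact h0
  | succ n ih =>
    ext A hA
    have hm : Measurable (A.indicator (1 : S → ℝ≥0∞)) := measurable_one.indicator hA
    have h := hQ n (fun _ => 1) (A.indicator 1) measurable_const (fun _ _ _ => rfl) hm
    simp only [one_mul, lintegral_indicator_one hA] at h
    rw [← lintegral_map (f := A.indicator 1) (g := fun w : ℕ → S => w (n + 1)) hm (by fun_prop),
      lintegral_indicator_one hA,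
      ← lintegral_map (f := fun x => κ x A) (g := fun w : ℕ → S => w n)
        (Kernel.measurable_coe _ hA) (by fun_prop), ih,
      ← Measure.bind_apply hA κ.aemeasurable, hκ.def] at h
    exact h

/-- The `ℝ≥0∞`-valued Markov property becomes an identity of measures, so that Fubini is available
for signed integrands. The earlier coordinate `w i` is kept for correlations. -/
lemma map_eq_compProd [IsMarkovKernel κ] [IsFiniteMeasure Q] (hQ : IsMarkovLaw κ Q) {i n : ℕ}
    (hin : i ≤ n) :
    Q.map (fun w => ((w i, w n), w (n + 1))) =
      Q.map (fun w => (w i, w n)) ⊗ₘ (κ.comap (Prod.snd : S × S → S) measurable_snd) := by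
  refine Measure.ext_prod fun {s t} hs ht => ?_
  have hs' : MeasurableSet ((fun w : ℕ → S => (w i, w n)) ⁻¹' s) :=
    (by fun_prop : Measurable fun w : ℕ → S => (w i, w n)) hs
  have h := hQ n (fun w => s.indicator 1 (w i, w n)) (t.indicator 1)
    ((measurable_one.indicator hs).comp (by fun_prop)) (fun x y hxy => by
      simp only [hxy i (Set.mem_Iic.2 hin), hxy n (Set.mem_Iic.2 le_rfl)])
    (measurable_one.indicator ht)
  have hκm : Measurable fun q : S × S => κ q.2 t :=
    (Kernel.measurable_coe _ ht).comp measurable_snd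
  simp only [lintegral_indicator_one ht] at h
  rw [Measure.map_apply (by fun_prop) (hs.prod ht), Measure.compProd_apply_prod hs ht,
    setLIntegral_map hs (by exact hκm) (by fun_prop)]
  simp only [Kernel.comap_apply]
  rw [← lintegral_indicator hs', ← lintegral_indicator_one
    ((by fun_prop : Measurable fun w : ℕ → S => ((w i, w n), w (n + 1))) (hs.prod ht))]
  refine Eq.trans (lintegral_congr fun w => ?_) (h.trans (lintegral_congr fun w => ?_))
  · simp only [Set.indicator, Set.mem_preimage, Set.mem_prod, Pi.one_apply]
    split_ifs <;> simp_all
  · by_cases hw : (w i, w n) ∈ s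
    · rw [Set.indicator_of_mem hw, Set.indicator_of_mem (by exact hw)]; simp
    · rw [Set.indicator_of_notMem hw, Set.indicator_of_notMem (by exact hw)]; simp

/-- Evaluation of an `L²` function along the chain at time `n`. -/
def evalLp (hQ : IsMarkovLaw κ Q) (hκ : κ.Invariant π)
    (h0 : Q.map (fun w => w 0) = π) (n : ℕ) : Lp ℝ 2 π →ₗᵢ[ℝ] Lp ℝ 2 Q :=
  Lp.compMeasurePreservingₗᵢ ℝ _ (hQ.measurePreserving_eval hκ h0 n)

/-- The Markov operator on `L²(π)`. -/
def markovOp (hQ : IsMarkovLaw κ Q) (hκ : κ.Invariant π)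
    (h0 : Q.map (fun w => w 0) = π) : Lp ℝ 2 π →L[ℝ] Lp ℝ 2 π :=
  (ContinuousLinearMap.adjoint (hQ.evalLp hκ h0 0).toContinuousLinearMap) ∘L
    (hQ.evalLp hκ h0 1).toContinuousLinearMap

section MarkovOperator

variable (hQ : IsMarkovLaw κ Q) (hκ : κ.Invariant π) (h0 : Q.map (fun w => w 0) = π)

lemma coeFn_evalLp (n : ℕ) (f : Lp ℝ 2 π) :
    hQ.evalLp hκ h0 n f =ᵐ[Q] fun w => f (w n) :=
  Lp.coeFn_compMeasurePreserving f (hQ.measurePreserving_eval hκ h0 n)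

lemma norm_markovOp_le : ‖hQ.markovOp hκ h0‖ ≤ 1 := by
  refine (ContinuousLinearMap.opNorm_comp_le _ _).trans ?_
  rw [LinearIsometryEquiv.norm_map]
  exact mul_le_one₀ (LinearIsometry.norm_toContinuousLinearMap_le _) (norm_nonneg _)
    (LinearIsometry.norm_toContinuousLinearMap_le _)

lemma inner_markovOp (f g : Lp ℝ 2 π) :
    ⟪g, hQ.markovOp hκ h0 f⟫_ℝ = ⟪hQ.evalLp hκ h0 0 g, hQ.evalLp hκ h0 1 f⟫_ℝ := by
  simp [markovOp, ContinuousLinearMap.adjoint_inner_right]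

lemma inner_evalLp (i n : ℕ) (f g : Lp ℝ 2 π) :
    ⟪hQ.evalLp hκ h0 i g, hQ.evalLp hκ h0 n f⟫_ℝ = ∫ w, g (w i) * f (w n) ∂Q := by
  rw [L2.inner_def]
  refine integral_congr_ae ?_
  filter_upwards [hQ.coeFn_evalLp hκ h0 i g, hQ.coeFn_evalLp hκ h0 n f] with w h1 h2
  rw [h1, h2]; simp [mul_comm]

variable [IsMarkovKernel κ] [IsProbabilityMeasure Q]

lemma inner_evalLp_succ_eq_integral {i n : ℕ} (hin : i ≤ n) (f g : Lp ℝ 2 π) :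
    ⟪hQ.evalLp hκ h0 i g, hQ.evalLp hκ h0 (n + 1) f⟫_ℝ =
      ∫ w, g (w i) * ∫ y, f y ∂κ (w n) ∂Q := by
  have hint : Integrable (fun w : ℕ → S => g (w i) * f (w (n + 1))) Q :=
    ((Lp.memLp g).comp_measurePreserving
      (hQ.measurePreserving_eval hκ h0 i)).integrable_mul
      ((Lp.memLp f).comp_measurePreserving (hQ.measurePreserving_eval hκ h0 (n + 1)))
  have hg := (Lp.stronglyMeasurable g).measurable
  have hf := (Lp.stronglyMeasurable f).measurable
  have hm : StronglyMeasurable fun q : (S × S) × S => g q.1.1 * f q.2 := by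
    apply Measurable.stronglyMeasurable; fun_prop
  have hmap := hQ.map_eq_compProd hin
  rw [inner_evalLp]
  have e1 : ∫ w, g (w i) * f (w (n + 1)) ∂Q =
      ∫ q, g q.1.1 * f q.2 ∂Q.map (fun w => ((w i, w n), w (n + 1))) :=
    (integral_map (φ := fun w : ℕ → S => ((w i, w n), w (n + 1))) (by fun_prop)
      hm.aestronglyMeasurable).symm
  have hint' : Integrable (fun q : (S × S) × S => g q.1.1 * f q.2)
      (Q.map (fun w => ((w i, w n), w (n + 1)))) :=
    (integrable_map_measure hm.aestronglyMeasurable (by fun_prop)).2 hint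
  rw [e1]
  rw [hmap] at hint' ⊢
  rw [Measure.integral_compProd hint', integral_map (by fun_prop)]
  · simp [integral_const_mul]
  · exact (StronglyMeasurable.integral_kernel_prod_right' hm).aestronglyMeasurable

variable [IsProbabilityMeasure π]

/-- Composing one isometry with the adjoint of another makes `markovOp` a contraction at once; its
kernel formula is recovered here by testing against indicators. -/
lemma markovOp_ae_eq (f : Lp ℝ 2 π) :
    hQ.markovOp hκ h0 f =ᵐ[π] fun x => ∫ y, f y ∂κ x := by
  have hf := Lp.stronglyMeasurable f
  have hPm : StronglyMeasurable fun x => ∫ y, f y ∂κ x := hf.integral_kernel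
  have hPi : Integrable (fun x => ∫ y, f y ∂κ x) π := by
    have h1 : Integrable f (κ ∘ₘ π) := by
      rw [hκ.def]
      exact (Lp.memLp f).integrable one_le_two
    have h2 := ((Measure.integrable_comp_iff h1.aestronglyMeasurable).1 h1).2
    refine h2.mono' hPm.aestronglyMeasurable (Eventually.of_forall fun x => ?_)
    exact norm_integral_le_integral_norm _
  refine Integrable.ae_eq_of_forall_setIntegral_eq _ _
    ((Lp.memLp _).integrable one_le_two) hPi fun A hA _ => ?_
  rw [← L2.inner_indicatorConstLp_one (𝕜 := ℝ) hA (measure_ne_top π A), inner_markovOp]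
  refine (hQ.inner_evalLp_succ_eq_integral hκ h0 (le_refl 0) f _).trans ?_
  have hmap := integral_map (μ := Q) (measurable_pi_apply (0 : ℕ)).aemeasurable
    (hPm.indicator hA).aestronglyMeasurable
  rw [h0] at hmap
  rw [← integral_indicator hA, hmap]
  refine integral_congr_ae ?_
  have h3 := (hQ.measurePreserving_eval hκ h0 0).quasiMeasurePreserving.ae
    (indicatorConstLp_coeFn (p := 2) (hs := hA) (hμs := measure_ne_top π A) (c := (1 : ℝ)))
  filter_upwards [h3] with w hw
  rw [hw]
  by_cases hwA : w 0 ∈ A <;> simp [hwA]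

lemma inner_evalLp_succ {i n : ℕ} (hin : i ≤ n) (f g : Lp ℝ 2 π) :
    ⟪hQ.evalLp hκ h0 i g, hQ.evalLp hκ h0 (n + 1) f⟫_ℝ =
      ⟪hQ.evalLp hκ h0 i g, hQ.evalLp hκ h0 n (hQ.markovOp hκ h0 f)⟫_ℝ := by
  rw [hQ.inner_evalLp_succ_eq_integral hκ h0 hin, hQ.inner_evalLp]
  refine integral_congr_ae ?_
  filter_upwards [(hQ.measurePreserving_eval hκ h0 n).quasiMeasurePreserving.ae
    (hQ.markovOp_ae_eq hκ h0 f)] with w hw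
  rw [hw]

/-- Stationarity: correlations depend on the lag `d` only. -/
lemma inner_evalLp_add (i d : ℕ) (f g : Lp ℝ 2 π) :
    ⟪hQ.evalLp hκ h0 i g, hQ.evalLp hκ h0 (i + d) f⟫_ℝ =
      ⟪g, ((hQ.markovOp hκ h0)^[d]) f⟫_ℝ := by
  induction d generalizing f with
  | zero => simp
  | succ d ih =>
    rw [← add_assoc, hQ.inner_evalLp_succ hκ h0 (Nat.le_add_right i d), ih,
      Function.iterate_succ_apply]

/-- A function fixed by the Markov operator is constant along the stationary chain. -/
lemma ae_eq_of_markovOp_eq {f : Lp ℝ 2 π} (hf : hQ.markovOp hκ h0 f = f) :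
    ∀ᵐ w ∂Q, ∀ n, f (w n) = f (w 0) := by
  rw [ae_all_iff]
  intro n
  have h1 : ∀ d, ((hQ.markovOp hκ h0)^[d]) f = f := fun d => Function.iterate_fixed hf d
  have h2 := hQ.inner_evalLp_add hκ h0 0 n f f
  rw [h1, zero_add] at h2
  -- The squared distance expands to `2‖f‖² - 2⟪f, Tⁿ f⟫`, which is `0` since `Tⁿ f = f`.
  have h3 : hQ.evalLp hκ h0 0 f = hQ.evalLp hκ h0 n f := by
    rw [← sub_eq_zero, ← norm_eq_zero, ← sq_eq_zero_iff, norm_sub_sq_real, h2,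
      LinearIsometry.norm_map, LinearIsometry.norm_map, real_inner_self_eq_norm_sq]
    ring
  have h4 := hQ.coeFn_evalLp hκ h0 n f
  rw [← h3] at h4
  filter_upwards [h4, hQ.coeFn_evalLp hκ h0 0 f] with w h5 h6
  rw [← h5, h6]

/-- If `f⁻¹' U` has positive measure, the chain visits it; as `f` is constant along the chain, `f (w
0) ∈ U` almost surely. So every such preimage is null or full, which forces `f` to be constant. -/
lemma exists_const_of_markovOp_eq
    (hvis : ∀ A, MeasurableSet A → 0 < π A → ∀ᵐ w ∂Q, ∃ᶠ k in atTop, w k ∈ A)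
    {f : Lp ℝ 2 π} (hf : hQ.markovOp hκ h0 f = f) : ∃ c : ℝ, f =ᵐ[π] fun _ => c := by
  have hfm := (Lp.stronglyMeasurable f).measurable
  refine exists_eventuallyEq_const_of_forall_separating MeasurableSet fun U hU => ?_
  by_cases hA : π (f ⁻¹' U) = 0
  · right
    exact measure_eq_zero_iff_ae_notMem.1 hA
  · left
    have h1 := hvis _ (hfm hU) (pos_iff_ne_zero.2 hA)
    have h2 : ∀ᵐ w ∂Q, f (w 0) ∈ U := by
      filter_upwards [h1, hQ.ae_eq_of_markovOp_eq hκ h0 hf] with w h3 h4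
      obtain ⟨k, hk⟩ := h3.exists
      rw [← h4 k]; exact hk
    have h5 := (ae_map_iff (f := fun w : ℕ → S => w 0) (measurable_pi_apply 0).aemeasurable
      (hfm hU : MeasurableSet {x | f x ∈ U})).2 h2
    rwa [h0] at h5

/-- Weak Cesàro decay of correlations for a centred function. -/
lemma tendsto_average_inner_iterate
    (hvis : ∀ A, MeasurableSet A → 0 < π A → ∀ᵐ w ∂Q, ∃ᶠ k in atTop, w k ∈ A)
    (f : Lp ℝ 2 π) (hf : ∫ x, f x ∂π = 0) :
    Tendsto (fun N : ℕ => (N : ℝ)⁻¹ * ∑ k ∈ Finset.range N, ⟪f, ((hQ.markovOp hκ h0)^[k]) f⟫_ℝ)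
      atTop (𝓝 0) := by
  set T := hQ.markovOp hκ h0
  have h1 := T.tendsto_birkhoffAverage_orthogonalProjection (hQ.norm_markovOp_le hκ h0) f
  -- Fixed vectors are constants, and a centred `f` is orthogonal to constants.
  have h2 : (T.eqLocus (1 : Lp ℝ 2 π →L[ℝ] Lp ℝ 2 π)).orthogonalProjectionOnto f = 0 := by
    rw [Submodule.orthogonalProjectionOnto_eq_zero_iff, Submodule.mem_orthogonal]
    intro u hu
    obtain ⟨c, hc⟩ := hQ.exists_const_of_markovOp_eq hκ h0 hvis (f := u) hu
    rw [L2.inner_def]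
    calc ∫ a, ⟪u a, f a⟫_ℝ ∂π = ∫ a, c * f a ∂π := by
          refine integral_congr_ae ?_
          filter_upwards [hc] with a ha
          rw [ha]; simp [mul_comm]
      _ = 0 := by rw [integral_const_mul, hf, mul_zero]
  rw [h2] at h1
  have h3 := (tendsto_const_nhds (x := f)).inner (𝕜 := ℝ) h1
  simp only [Submodule.coe_zero, inner_zero_right] at h3
  refine h3.congr fun N => ?_
  simp [birkhoffAverage, birkhoffSum, inner_smul_right, inner_sum]

/-- The squared norm of the sum is expressed through the partial sums `s` of the autocorrelations.
Since `s n / n → 0`, a further Cesàro mean bounds the squared norm divided by `N²`. -/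
lemma tendsto_norm_average_zero
    (hvis : ∀ A, MeasurableSet A → 0 < π A → ∀ᵐ w ∂Q, ∃ᶠ k in atTop, w k ∈ A)
    (f : Lp ℝ 2 π) (hf : ∫ x, f x ∂π = 0) :
    Tendsto (fun N : ℕ => (N : ℝ)⁻¹ • ∑ i ∈ Finset.range N, hQ.evalLp hκ h0 i f) atTop (𝓝 0) := by
  set T := hQ.markovOp hκ h0 with hT
  set V := hQ.evalLp hκ h0 with hV
  set c : ℕ → ℝ := fun k => ⟪f, (T^[k]) f⟫_ℝ with hc
  set s : ℕ → ℝ := fun n => ∑ k ∈ Finset.range n, c k with hs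
  have hs0 : Tendsto (fun N : ℕ => (N : ℝ)⁻¹ * s N) atTop (𝓝 0) :=
    hQ.tendsto_average_inner_iterate hκ h0 hvis f hf
  have hW : ∀ N : ℕ, ‖∑ i ∈ Finset.range N, V i f‖ ^ 2 =
      ∑ n ∈ Finset.range N, (2 * s (n + 1) - c 0) := by
    intro N
    induction N with
    | zero => simp
    | succ N ih =>
      have h1 : ⟪∑ i ∈ Finset.range N, V i f, V N f⟫_ℝ = s (N + 1) - c 0 := by
        rw [sum_inner, hs]
        simp only
        -- Reversing the order turns lag `N - i` into the index; dropping lag `0` accounts for `- c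
        -- 0`.
        rw [Finset.sum_range_succ', add_sub_cancel_right, ← Finset.sum_range_reflect]
        refine Finset.sum_congr rfl fun i hi => ?_
        have hi := Finset.mem_range.1 hi
        have := hQ.inner_evalLp_add hκ h0 (N - 1 - i) (i + 1) f f
        rw [show N - 1 - i + (i + 1) = N by omega] at this
        exact this
      rw [Finset.sum_range_succ, norm_add_sq_real, ih, h1, Finset.sum_range_succ,
        LinearIsometry.norm_map]
      simp only [hc, Function.iterate_zero, id_eq, real_inner_self_eq_norm_sq]
      ring
  have hb : Tendsto (fun n : ℕ => 2 * |((n + 1 : ℕ) : ℝ)⁻¹ * s (n + 1)|) atTop (𝓝 0) := by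
    have := ((tendsto_add_atTop_iff_nat 1).2 hs0).abs.const_mul 2
    simpa using this
  have hlim : Tendsto (fun N : ℕ => (N : ℝ)⁻¹ * (∑ n ∈ Finset.range N,
      2 * |((n + 1 : ℕ) : ℝ)⁻¹ * s (n + 1)|) + (N : ℝ)⁻¹ * |c 0|) atTop (𝓝 0) := by
    have := hb.cesaro.add ((tendsto_inv_atTop_nhds_zero_nat (𝕜 := ℝ)).mul_const |c 0|)
    simpa using this
  rw [tendsto_zero_iff_norm_tendsto_zero]
  have hsq : Tendsto (fun N : ℕ =>
      ‖(N : ℝ)⁻¹ • ∑ i ∈ Finset.range N, V i f‖ ^ 2) atTop (𝓝 0) := by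
    refine squeeze_zero (fun _ => sq_nonneg _) (fun N => ?_) hlim
    rcases Nat.eq_zero_or_pos N with rfl | hN
    · simp
    have hN' : (0 : ℝ) < N := by exact_mod_cast hN
    rw [norm_smul, mul_pow, hW, Real.norm_of_nonneg (by positivity)]
    have h5 : ∑ n ∈ Finset.range N, (2 * s (n + 1) - c 0) ≤
        N * (∑ n ∈ Finset.range N, 2 * |((n + 1 : ℕ) : ℝ)⁻¹ * s (n + 1)| + |c 0|) := by
      rw [mul_add, Finset.mul_sum, Finset.sum_sub_distrib, Finset.sum_const, Finset.card_range,
        nsmul_eq_mul]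
      have h6 : ∑ n ∈ Finset.range N, 2 * s (n + 1) ≤
          ∑ n ∈ Finset.range N, N * (2 * |((n + 1 : ℕ) : ℝ)⁻¹ * s (n + 1)|) := by
        refine Finset.sum_le_sum fun n hn => ?_
        have hn' : ((n + 1 : ℕ) : ℝ) ≤ N := by exact_mod_cast Finset.mem_range.1 hn
        have hn0 : (0 : ℝ) < ((n + 1 : ℕ) : ℝ) := by positivity
        rw [abs_mul, abs_of_pos (inv_pos.2 hn0)]
        have h7 : |s (n + 1)| ≤ N * (((n + 1 : ℕ) : ℝ)⁻¹ * |s (n + 1)|) := by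
          rw [← mul_assoc]
          refine le_mul_of_one_le_left (abs_nonneg _) ?_
          rw [← div_eq_mul_inv, one_le_div hn0]
          exact hn'
        linarith [le_abs_self (s (n + 1))]
      have h8 : -((N : ℝ) * c 0) ≤ N * |c 0| := by
        rw [← mul_neg]
        exact mul_le_mul_of_nonneg_left (neg_le_abs _) hN'.le
      linarith
    calc ((N : ℝ)⁻¹) ^ 2 * ∑ n ∈ Finset.range N, (2 * s (n + 1) - c 0)
        ≤ ((N : ℝ)⁻¹) ^ 2 *
          (N * (∑ n ∈ Finset.range N, 2 * |((n + 1 : ℕ) : ℝ)⁻¹ * s (n + 1)| + |c 0|)) := by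
          gcongr
      _ = _ := by field_simp
  have := hsq.sqrt
  simpa using this

end MarkovOperator

/-- The law of large numbers in probability for the stationary chain. -/
lemma tendstoInMeasure_average [IsMarkovKernel κ] [IsProbabilityMeasure Q] [IsProbabilityMeasure π]
    (hQ : IsMarkovLaw κ Q) (hκ : κ.Invariant π) (h0 : Q.map (fun w => w 0) = π)
    (hvis : ∀ A, MeasurableSet A → 0 < π A → ∀ᵐ w ∂Q, ∃ᶠ k in atTop, w k ∈ A)
    {f : S → ℝ} (hf : MemLp f 2 π) :
    TendstoInMeasure Q (fun (N : ℕ) w => (N : ℝ)⁻¹ * ∑ i ∈ Finset.range N, f (w i)) atTop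
      (fun _ => ∫ x, f x ∂π) := by
  set c := ∫ x, f x ∂π with hc
  have hf0 : MemLp (fun x => f x - c) 2 π := hf.sub (memLp_const c)
  have hint : ∫ x, hf0.toLp _ x ∂π = 0 := by
    rw [integral_congr_ae hf0.coeFn_toLp, integral_sub (hf.integrable one_le_two)
      (integrable_const c)]
    simp [hc]
  have h1 := tendstoInMeasure_of_tendsto_Lp
    (hQ.tendsto_norm_average_zero hκ h0 hvis (hf0.toLp _) hint)
  rw [tendstoInMeasure_iff_norm] at h1 ⊢
  intro ε hε
  refine (h1 ε hε).congr' ?_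
  filter_upwards [eventually_gt_atTop 0] with N hN
  have hN' : (N : ℝ) ≠ 0 := by exact_mod_cast hN.ne'
  have h2 : ∀ᵐ w ∂Q, ∀ i, hQ.evalLp hκ h0 i (hf0.toLp _) w = f (w i) - c := by
    rw [ae_all_iff]
    intro i
    filter_upwards [hQ.coeFn_evalLp hκ h0 i (hf0.toLp _),
      (hQ.measurePreserving_eval hκ h0 i).quasiMeasurePreserving.ae hf0.coeFn_toLp] with w h3 h4
    rw [h3, h4]
  refine measure_congr ?_
  filter_upwards [h2, Lp.coeFn_smul (N : ℝ)⁻¹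
    (∑ i ∈ Finset.range N, hQ.evalLp hκ h0 i (hf0.toLp _)),
    Lp.coeFn_fun_finsetSum (Finset.range N) (fun i => hQ.evalLp hκ h0 i (hf0.toLp _)),
    Lp.coeFn_zero ℝ 2 Q] with w h3 h4 h5 h6
  have : ((N : ℝ)⁻¹ • ∑ i ∈ Finset.range N, hQ.evalLp hκ h0 i (hf0.toLp _) : Lp ℝ 2 Q) w -
      (0 : Lp ℝ 2 Q) w = (N : ℝ)⁻¹ * ∑ i ∈ Finset.range N, f (w i) - c := by
    rw [h4, h6, Pi.smul_apply, h5]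
    simp only [h3, Finset.sum_sub_distrib, Finset.sum_const, Finset.card_range, smul_eq_mul,
      nsmul_eq_mul, Pi.zero_apply, sub_zero]
    field_simp
  change (ε ≤ ‖_‖) = (ε ≤ ‖_‖)
  rw [this]

end IsMarkovLaw

end Stationary

/-! ### From the stationary chain to an arbitrary initial law. -/

section HarrisChain

open scoped ENNReal

variable {S : Type*} [MeasurableSpace S]

/-- On finite measures, convergence in measure means that every subsequence has an a.e. convergent
subsubsequence, a property inherited by dominated measures. -/
lemma MeasureTheory.TendstoInMeasure.of_absolutelyContinuous {α : Type*} {mα : MeasurableSpace α}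
    {μ ν : Measure α} [IsFiniteMeasure μ] [IsFiniteMeasure ν] (hνμ : ν ≪ μ) {f : ℕ → α → ℝ}
    {g : α → ℝ} (hf : ∀ n, Measurable (f n)) (h : TendstoInMeasure μ f atTop g) :
    TendstoInMeasure ν f atTop g := by
  rw [exists_seq_tendstoInMeasure_atTop_iff fun n => (hf n).aestronglyMeasurable] at h ⊢
  intro ns hns
  obtain ⟨ns', h1, h2⟩ := h ns hns
  exact ⟨ns', h1, hνμ.ae_le h2⟩

/-- `B` is a common null set of the singular parts of all `ν k`, each of which lives on a `π`-null
set. -/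
lemma exists_measurableSet_restrict_absolutelyContinuous (ν : ℕ → Measure S) (π : Measure S)
    [∀ k, IsFiniteMeasure (ν k)] [IsFiniteMeasure π] :
    ∃ B, MeasurableSet B ∧ π Bᶜ = 0 ∧ ∀ k, (ν k).restrict B ≪ π := by
  have hs : ∀ k, (ν k).singularPart π ⟂ₘ π := fun k => Measure.mutuallySingular_singularPart _ _
  refine ⟨⋂ k, (hs k).nullSet, MeasurableSet.iInter fun k => (hs k).measurableSet_nullSet, ?_, ?_⟩
  · rw [Set.compl_iInter, measure_iUnion_null_iff]
    exact fun k => (hs k).measure_compl_nullSet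
  · intro k
    refine Measure.AbsolutelyContinuous.mk fun A hA hπA => ?_
    rw [Measure.restrict_apply hA, (ν k).haveLebesgueDecomposition_add π, Measure.add_apply]
    refine add_eq_zero.2 ⟨measure_mono_null ?_ (hs k).measure_nullSet,
      measure_mono_null Set.inter_subset_left (withDensity_absolutelyContinuous _ _ hπA)⟩
    exact Set.inter_subset_right.trans (Set.iInter_subset _ k)

lemma IsHarrisRecurrent.ae_frequently_mem {κ : Kernel S S} [IsMarkovKernel κ] {π : Measure S}
    (hH : IsHarrisRecurrent κ π) (μ : Measure S) {A : Set S}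
    (hA : MeasurableSet A) (hπA : 0 < π A) : ∀ᵐ w ∂chainLaw κ μ, ∃ᶠ k in atTop, w k ∈ A := by
  have hm : MeasurableSet {w : ℕ → S | ¬ ∃ᶠ k in atTop, w k ∈ A} := by
    have : {w : ℕ → S | ¬ ∃ᶠ k in atTop, w k ∈ A} =
        ⋃ n : ℕ, ⋂ k : ℕ, ⋂ (_ : n ≤ k), (fun w => w k) ⁻¹' Aᶜ := by
      ext w; simp [frequently_atTop]
    rw [this]
    exact MeasurableSet.iUnion fun n => MeasurableSet.iInter fun k => MeasurableSet.iInter fun _ =>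
      measurable_pi_apply k hA.compl
  rw [ae_iff, chainLaw_apply κ μ hm, lintegral_eq_zero_iff' ?_]
  · exact Eventually.of_forall fun x => ae_iff.1 (hH A hA hπA x)
  · have : (fun x => chainLaw κ (Measure.dirac x) {w : ℕ → S | ¬ ∃ᶠ k in atTop, w k ∈ A}) =
      fun _ => 0 := funext fun x => ae_iff.1 (hH A hA hπA x)
    rw [this]
    exact aemeasurable_const

namespace IsMarkovLaw

variable {κ : Kernel S S} [IsMarkovKernel κ] {π : Measure S} [IsProbabilityMeasure π]

/-- A Markov law whose initial law has a density with respect to `π` is absolutely continuous with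
respect to the stationary chain. -/
lemma absolutelyContinuous_chainLaw {Q : Measure (ℕ → S)} [IsFiniteMeasure Q]
    (hQ : IsMarkovLaw κ Q) (h0 : Q.map (fun w => w 0) ≪ π) : Q ≪ chainLaw κ π := by
  set ρ := (Q.map fun w => w 0).rnDeriv π with hρ
  have hρm : Measurable ρ := Measure.measurable_rnDeriv _ _
  have hπ : π.withDensity ρ = Q.map fun w => w 0 := Measure.withDensity_rnDeriv_eq _ _ h0
  have hD : Measurable fun w : ℕ → S => ρ (w 0) := by fun_prop
  have hmap : ((chainLaw κ π).withDensity fun w => ρ (w 0)).map (fun w => w 0) =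
      Q.map fun w => w 0 := by
    rw [← hπ]
    ext A hA
    rw [Measure.map_apply (by fun_prop) hA,
      withDensity_apply _ (measurable_pi_apply (0 : ℕ) hA), withDensity_apply _ hA]
    conv_rhs => rw [← chainLaw_map_zero κ π]
    rw [setLIntegral_map hA hρm (by fun_prop)]
  have hfin : IsFiniteMeasure ((chainLaw κ π).withDensity fun w => ρ (w 0)) := by
    constructor
    have := congrArg (fun M => M Set.univ) hmap
    rw [Measure.map_apply (by fun_prop) MeasurableSet.univ, Set.preimage_univ] at this
    rw [this]
    exact measure_lt_top _ _
  -- Both sides are Markov laws for `κ` with the same initial law, so uniqueness applies.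
  have heq : Q = (chainLaw κ π).withDensity fun w => ρ (w 0) := by
    refine hQ.ext (fun n F h hF hFd hh => ?_) hmap.symm
    exact (isMarkovLaw_chainLaw κ π).withDensity hD
      (k := 0) (fun x y hxy => by simp [hxy 0 (by simp)]) (Nat.zero_le n) hF hFd hh
  rw [heq]
  exact withDensity_absolutelyContinuous _ _

lemma tendstoInMeasure_of_absolutelyContinuous (hκ : κ.Invariant π) (hH : IsHarrisRecurrent κ π)
    {Q : Measure (ℕ → S)} [IsFiniteMeasure Q] (hQ : IsMarkovLaw κ Q)
    (h0 : Q.map (fun w => w 0) ≪ π) {f : S → ℝ} (hf : Measurable f) {C : ℝ} (hC : ∀ x, |f x| ≤ C) :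
    TendstoInMeasure Q (fun (N : ℕ) w => (N : ℝ)⁻¹ * ∑ i ∈ Finset.range N, f (w i)) atTop
      (fun _ => ∫ x, f x ∂π) := by
  refine TendstoInMeasure.of_absolutelyContinuous (hQ.absolutelyContinuous_chainLaw h0)
    (fun N => ?_) ?_
  · exact (Finset.measurable_sum _ fun i _ => hf.comp (measurable_pi_apply i)).const_mul _
  · exact (isMarkovLaw_chainLaw κ π).tendstoInMeasure_average hκ (chainLaw_map_zero κ π)
      (fun A hA hπA => hH.ae_frequently_mem π hA hπA)
      (MemLp.of_bound hf.aestronglyMeasurable C (Eventually.of_forall hC))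

end IsMarkovLaw

/-- The two sums differ by `k` terms at the start and `k` at the end. -/
lemma abs_average_sub_average_trajShift_le {S : Type*} {f : S → ℝ} {C : ℝ} (hC : ∀ x, |f x| ≤ C)
    (k N : ℕ)
    (w : ℕ → S) : |(N : ℝ)⁻¹ * ∑ i ∈ Finset.range N, f (w i) -
      (N : ℝ)⁻¹ * ∑ i ∈ Finset.range N, f (trajShift k w i)| ≤ (N : ℝ)⁻¹ * (2 * k * C) := by
  have h1 := Finset.sum_range_add (fun i => f (w i)) k N
  have h2 := Finset.sum_range_add (fun i => f (w i)) N k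
  rw [add_comm] at h1
  have h3 : ∑ i ∈ Finset.range N, f (w i) - ∑ i ∈ Finset.range N, f (trajShift k w i) =
      ∑ i ∈ Finset.range k, f (w i) - ∑ i ∈ Finset.range k, f (w (N + i)) := by
    simp only [trajShift]
    linarith
  have hb : ∀ u : ℕ → S, |∑ i ∈ Finset.range k, f (u i)| ≤ k * C := fun u =>
    (Finset.abs_sum_le_sum_abs _ _).trans
      ((Finset.sum_le_sum fun i _ => hC (u i)).trans (by simp))
  rw [← mul_sub, h3, abs_mul, abs_of_nonneg (by positivity : (0 : ℝ) ≤ (N : ℝ)⁻¹)]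
  gcongr
  calc _ ≤ |∑ i ∈ Finset.range k, f (w i)| + |∑ i ∈ Finset.range k, f (w (N + i))| := abs_sub _ _
    _ ≤ k * C + k * C := add_le_add (hb w) (hb fun i => w (N + i))
    _ = _ := by ring

/-- The law of large numbers in probability for bounded functions along a Harris recurrent chain
with an invariant probability measure, from any initial law. -/
theorem IsHarrisRecurrent.tendstoInMeasure_average {κ : Kernel S S} [IsMarkovKernel κ]
    {π : Measure S} [IsProbabilityMeasure π] (hH : IsHarrisRecurrent κ π) (hκ : κ.Invariant π)
    (μ : Measure S) [IsProbabilityMeasure μ] {f : S → ℝ} (hf : Measurable f) {C : ℝ}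
    (hC : ∀ x, |f x| ≤ C) :
    TendstoInMeasure (chainLaw κ μ)
      (fun (N : ℕ) w => (N : ℝ)⁻¹ * ∑ i ∈ Finset.range N, f (w i)) atTop
      (fun _ => ∫ x, f x ∂π) := by
  set P := chainLaw κ μ with hP
  set c := ∫ x, f x ∂π
  set A : ℕ → (ℕ → S) → ℝ := fun N w => (N : ℝ)⁻¹ * ∑ i ∈ Finset.range N, f (w i) with hA
  have hAm : ∀ N, Measurable (A N) := fun N =>
    (Finset.measurable_sum _ fun i _ => hf.comp (measurable_pi_apply i)).const_mul _
  obtain ⟨B, hB, hπB, hac⟩ :=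
    exists_measurableSet_restrict_absolutelyContinuous (fun k => P.map fun w => w k) π
  have hDm : ∀ k, MeasurableSet {w : ℕ → S | w k ∈ B} := fun k => measurable_pi_apply k hB
  have hk : ∀ (k : ℕ) (ε : ℝ), 0 < ε →
      Tendsto (fun N => P ({w | ε ≤ ‖A N w - c‖} ∩ {w | w k ∈ B})) atTop (𝓝 0) := by
    intro k ε hε
    -- The law of the chain restarted at time `k` on the event `w k ∈ B`; its initial law is
    -- dominated by `π`.
    set Q := (P.withDensity ({w : ℕ → S | w k ∈ B}.indicator 1)).map (trajShift k) with hQdef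
    have hQr : Q = (P.restrict {w | w k ∈ B}).map (trajShift k) := by
      rw [hQdef, withDensity_indicator_one (hDm k)]
    have hQ : IsMarkovLaw κ Q := by
      refine (isMarkovLaw_chainLaw κ μ).map_shift (measurable_one.indicator (hDm k))
        fun x y hxy => ?_
      have e : x k = y k := hxy k (Set.mem_Iic.2 le_rfl)
      change B.indicator (fun _ => (1 : ℝ≥0∞)) (x k) = B.indicator (fun _ => 1) (y k)
      rw [e]
    have hQf : IsFiniteMeasure Q := by rw [hQr]; infer_instance
    have hQ0 : Q.map (fun w => w 0) ≪ π := by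
      have : Q.map (fun w => w 0) = (P.map fun w => w k).restrict B := by
        rw [hQr, Measure.map_map (by fun_prop) (by fun_prop),
          Measure.restrict_map (by fun_prop) hB]
        rfl
      rw [this]
      exact hac k
    have h1 := hQ.tendstoInMeasure_of_absolutelyContinuous hκ hH hQ0 hf hC
    rw [tendstoInMeasure_iff_norm] at h1
    have h2 : ∀ᶠ N : ℕ in atTop, (N : ℝ)⁻¹ * (2 * k * C) < ε / 2 := by
      have := (tendsto_inv_atTop_nhds_zero_nat (𝕜 := ℝ)).mul_const (2 * k * C)
      rw [zero_mul] at this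
      exact this.eventually_lt_const (half_pos hε)
    refine tendsto_of_tendsto_of_tendsto_of_le_of_le' tendsto_const_nhds (h1 (ε / 2) (half_pos hε))
      (Eventually.of_forall fun _ => zero_le) ?_
    filter_upwards [h2] with N hN
    have hm : MeasurableSet {w : ℕ → S | ε / 2 ≤ ‖A N w - c‖} :=
      measurableSet_le measurable_const ((hAm N).sub_const c).norm
    rw [hQr, Measure.map_apply (by fun_prop) hm,
      Measure.restrict_apply (measurable_trajShift k hm)]
    refine measure_mono (Set.inter_subset_inter_left _ fun w hw => ?_)
    have h3 := abs_average_sub_average_trajShift_le hC k N w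
    have h4 : ε ≤ |A N w - c| := hw
    change ε / 2 ≤ |A N (trajShift k w) - c|
    have h5 : |A N w - A N (trajShift k w)| ≤ (N : ℝ)⁻¹ * (2 * k * C) := h3
    have h6 := abs_sub_le (A N w) (A N (trajShift k w)) c
    linarith
  -- Recurrence is used here for a non-stationary start: `B` has full `π`-measure, so it is hit
  -- almost surely.
  have hhit : Tendsto (fun K : ℕ => P {w | ∀ k < K, w k ∉ B}) atTop (𝓝 0) := by
    have hms : ∀ K : ℕ, MeasurableSet {w : ℕ → S | ∀ k < K, w k ∉ B} := fun K => by
      have : {w : ℕ → S | ∀ k < K, w k ∉ B} = ⋂ k, ⋂ (_ : k < K), {w | w k ∈ B}ᶜ := by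
        ext; simp
      rw [this]
      exact MeasurableSet.iInter fun k => MeasurableSet.iInter fun _ => (hDm k).compl
    have h1 := tendsto_measure_iInter_atTop (μ := P) (fun K => (hms K).nullMeasurableSet)
      (fun K K' hKK' w hw k hk => hw k (lt_of_lt_of_le hk hKK')) ⟨0, measure_ne_top _ _⟩
    have hπB' : 0 < π B := by
      rw [prob_compl_eq_zero_iff hB] at hπB
      simp [hπB]
    have h2 : P (⋂ K : ℕ, {w : ℕ → S | ∀ k < K, w k ∉ B}) = 0 := by
      refine measure_mono_null (fun w hw => ?_) (ae_iff.1 (hH.ae_frequently_mem μ hB hπB'))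
      simp only [Set.mem_iInter, Set.mem_ofPred_eq] at hw ⊢
      intro hfreq
      obtain ⟨k, hk⟩ := hfreq.exists
      exact hw (k + 1) k (Nat.lt_succ_self k) hk
    rwa [h2] at h1
  rw [tendstoInMeasure_iff_norm]
  intro ε hε
  rw [ENNReal.tendsto_nhds_zero]
  intro δ hδ
  obtain ⟨K, hK⟩ := ((ENNReal.tendsto_nhds_zero.1 hhit) (δ / 2) (ENNReal.half_pos hδ.ne')).exists
  have hsum : Tendsto (fun N => ∑ k ∈ Finset.range K, P ({w | ε ≤ ‖A N w - c‖} ∩ {w | w k ∈ B}))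
      atTop (𝓝 0) := by
    simpa using tendsto_finsetSum (Finset.range K) fun k _ => hk k ε hε
  filter_upwards [(ENNReal.tendsto_nhds_zero.1 hsum) (δ / 2) (ENNReal.half_pos hδ.ne')] with N hN
  have hsub : {w | ε ≤ ‖A N w - c‖} ⊆ (⋃ k ∈ Finset.range K,
      ({w | ε ≤ ‖A N w - c‖} ∩ {w | w k ∈ B})) ∪ {w | ∀ k < K, w k ∉ B} := by
    intro w hw
    by_cases h : ∀ k < K, w k ∉ B
    · exact Or.inr h
    · push Not at h
      obtain ⟨k, hkK, hkB⟩ := h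
      exact Or.inl (Set.mem_biUnion (Finset.mem_coe.2 (Finset.mem_range.2 hkK)) ⟨hw, hkB⟩)
  calc P {w | ε ≤ ‖A N w - c‖} ≤ _ := measure_mono hsub
    _ ≤ _ := measure_union_le _ _
    _ ≤ δ / 2 + δ / 2 := add_le_add ((measure_biUnion_finset_le _ _).trans hN) hK
    _ = δ := ENNReal.add_halves δ

end HarrisChain

/-! ### Laws of large numbers for the two sampling schemes. -/

section Sampling

variable {Ω S : Type*} [MeasurableSpace Ω] [MeasurableSpace S] {P : Measure Ω}
  [IsProbabilityMeasure P] {Y : ℕ → Ω → S} {π : Measure S}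

lemma IsIIDSample.tendstoInMeasure_average (hY : IsIIDSample P Y π) {f : S → ℝ}
    (hf : Measurable f) {C : ℝ} (hC : ∀ x, |f x| ≤ C) :
    TendstoInMeasure P (fun (N : ℕ) ω => (N : ℝ)⁻¹ * ∑ i ∈ Finset.range N, f (Y i ω)) atTop
      (fun _ => ∫ x, f x ∂π) := by
  have hm : ∀ i, Measurable fun ω => f (Y i ω) := fun i => hf.comp (hY.measurable i)
  refine tendstoInMeasure_of_tendsto_ae (fun N => ?_) ?_
  · exact ((Finset.measurable_sum _ fun i _ => hm i).const_mul _).aestronglyMeasurable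
  · have h := strong_law_ae (μ := P) (fun i ω => f (Y i ω))
      (Integrable.of_bound (hm 0).aestronglyMeasurable C (Eventually.of_forall fun ω => hC _))
      (fun i j hij => (hY.indep.indepFun hij).comp hf hf) (fun i =>
        (IdentDistrib.mk (hY.measurable i).aemeasurable (hY.measurable 0).aemeasurable
          ((hY.law i).trans (hY.law 0).symm)).comp hf)
    have e : ∫ ω, f (Y 0 ω) ∂P = ∫ x, f x ∂π := by
      rw [← hY.law 0, integral_map (hY.measurable 0).aemeasurable hf.aestronglyMeasurable]
    simpa only [e, smul_eq_mul] using h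

lemma IsMCMCSample.tendstoInMeasure_average [IsProbabilityMeasure π] (hY : IsMCMCSample P Y π)
    {f : S → ℝ}
    (hf : Measurable f) {C : ℝ} (hC : ∀ x, |f x| ≤ C) :
    TendstoInMeasure P (fun (N : ℕ) ω => (N : ℝ)⁻¹ * ∑ i ∈ Finset.range N, f (Y i ω)) atTop
      (fun _ => ∫ x, f x ∂π) := by
  obtain ⟨κ, _, hκ, hH, hlaw⟩ := hY.chain
  have hYm : Measurable fun ω i => Y i ω := measurable_pi_lambda _ hY.measurable
  have : IsProbabilityMeasure (P.map (Y 0)) :=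
    Measure.isProbabilityMeasure_map (hY.measurable 0).aemeasurable
  have h := hH.tendstoInMeasure_average hκ (P.map (Y 0)) hf hC
  rw [tendstoInMeasure_iff_norm] at h ⊢
  intro ε hε
  refine (h ε hε).congr fun N => ?_
  rw [← hlaw, Measure.map_apply hYm]
  · rfl
  · exact measurableSet_le measurable_const
      (((Finset.measurable_sum _ fun i _ => hf.comp (measurable_pi_apply i)).const_mul _).sub_const
        _).norm

end Sampling

/-! ### Exponential moments and local mass of the χ-density. -/

section ChiDensity

lemma chiDensity_nonneg (m : ℕ) {r : ℝ} (hr : 0 ≤ r) : 0 ≤ chiDensity m r := by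
  unfold chiDensity
  have : 0 ≤ Real.Gamma ((m : ℝ) / 2) := Real.Gamma_nonneg_of_nonneg (by positivity)
  positivity

lemma continuous_chiDensity (m : ℕ) : Continuous (chiDensity m) := by
  unfold chiDensity; fun_prop

lemma integrable_chiDensity_mul_exp (m : ℕ) (K : ℝ) :
    Integrable fun r => chiDensity m r * Real.exp (K * r) := by
  have h := integrable_rpow_mul_exp_neg_mul_sq (b := 1 / 4) (by norm_num)
    (s := ((m - 1 : ℕ) : ℝ)) (by have : (0 : ℝ) ≤ ((m - 1 : ℕ) : ℝ) := by positivity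
                                 linarith)
  simp only [Real.rpow_natCast] at h
  have hc := (h.norm.const_mul
    (|(2 : ℝ) ^ (1 - (m : ℝ) / 2) / Real.Gamma ((m : ℝ) / 2)| * Real.exp (K ^ 2)))
  refine hc.mono' ((continuous_chiDensity m).mul (by fun_prop)).aestronglyMeasurable
    (Eventually.of_forall fun r => ?_)
  simp only [chiDensity, norm_mul, Real.norm_eq_abs, Real.abs_exp]
  -- Completing the square, `(r / 2 - K)² ≥ 0`, keeps half of the Gaussian decay.
  have h1 : Real.exp (-r ^ 2 / 2) * Real.exp (K * r) ≤
      Real.exp (K ^ 2) * Real.exp (-(1 / 4) * r ^ 2) := by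
    rw [← Real.exp_add, ← Real.exp_add, Real.exp_le_exp]
    nlinarith [sq_nonneg (r / 2 - K)]
  calc _ = |(2 : ℝ) ^ (1 - (m : ℝ) / 2) / Real.Gamma ((m : ℝ) / 2)| * |r ^ (m - 1)| *
        (Real.exp (-r ^ 2 / 2) * Real.exp (K * r)) := by ring
    _ ≤ |(2 : ℝ) ^ (1 - (m : ℝ) / 2) / Real.Gamma ((m : ℝ) / 2)| * |r ^ (m - 1)| *
        (Real.exp (K ^ 2) * Real.exp (-(1 / 4) * r ^ 2)) := by gcongr
    _ = _ := by ring

lemma integrable_chiDensity (m : ℕ) : Integrable (chiDensity m) := by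
  simpa using integrable_chiDensity_mul_exp m 0

lemma exists_mul_chiDensity_mul_exp_le (m : ℕ) (K : ℝ) :
    ∃ M : ℝ, 0 ≤ M ∧ ∀ r, 0 ≤ r → r * (chiDensity m r * Real.exp (K * r)) ≤ M := by
  set c := (2 : ℝ) ^ (1 - (m : ℝ) / 2) / Real.Gamma ((m : ℝ) / 2) with hc
  have hc0 : 0 ≤ c := by
    have : 0 ≤ Real.Gamma ((m : ℝ) / 2) := Real.Gamma_nonneg_of_nonneg (by positivity)
    positivity
  -- The exponent is `m - 1 + 1`, not `m`: with truncated subtraction they differ at `m = 0`.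
  refine ⟨c * ((m - 1 + 1).factorial * Real.exp (K ^ 2 + 1)), by positivity, fun r hr => ?_⟩
  have h1 : r ^ (m - 1 + 1) ≤ (m - 1 + 1).factorial * Real.exp r := by
    have := Real.pow_div_factorial_le_exp r hr (m - 1 + 1)
    rwa [div_le_iff₀ (by positivity), mul_comm] at this
  have h2 : Real.exp r * (Real.exp (-r ^ 2 / 2) * Real.exp (K * r)) ≤ Real.exp (K ^ 2 + 1) := by
    rw [← Real.exp_add, ← Real.exp_add, Real.exp_le_exp]
    nlinarith [sq_nonneg (r / 2 - K), sq_nonneg (r / 2 - 1)]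
  calc r * (chiDensity m r * Real.exp (K * r))
      = c * (r ^ (m - 1 + 1) * (Real.exp (-r ^ 2 / 2) * Real.exp (K * r))) := by
        rw [chiDensity, ← hc]; ring
    _ ≤ c * (((m - 1 + 1).factorial * Real.exp r) *
        (Real.exp (-r ^ 2 / 2) * Real.exp (K * r))) := by gcongr
    _ = c * ((m - 1 + 1).factorial *
        (Real.exp r * (Real.exp (-r ^ 2 / 2) * Real.exp (K * r)))) := by ring
    _ ≤ _ := by gcongr

/-- The `χ`-mass of a short interval to the right of `ρ`, relative to its length. -/
lemma setIntegral_chiDensity_le {m : ℕ} {K M : ℝ} (hK : 0 ≤ K)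
    (hM : ∀ r, 0 ≤ r → r * (chiDensity m r * Real.exp (K * r)) ≤ M) {ρ s : ℝ} (hρ : 0 < ρ)
    (hs : 0 ≤ s) :
    ∫ r in {r | ρ < r ∧ r - ρ ≤ s * r}, chiDensity m r ≤
      Real.exp (-(K * ρ)) * s * ((∫ r in Set.Ioi 0, chiDensity m r * Real.exp (K * r)) + M) := by
  set h : ℝ → ℝ := fun r => chiDensity m r * Real.exp (K * r) with hh
  set D : Set ℝ := {r | ρ < r ∧ r - ρ ≤ s * r} with hD
  have hDm : MeasurableSet D :=
    (measurableSet_lt measurable_const measurable_id).inter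
      (measurableSet_le (f := fun r => r - ρ) (g := fun r => s * r) (by fun_prop) (by fun_prop))
  have hD0 : D ⊆ Set.Ioi 0 := fun r hr => hρ.trans hr.1
  have hint : Integrable h := integrable_chiDensity_mul_exp m K
  have hh0 : ∀ r, 0 ≤ r → 0 ≤ h r := fun r hr =>
    mul_nonneg (chiDensity_nonneg m hr) (Real.exp_nonneg _)
  have hM0 : 0 ≤ M := by simpa using hM 0 le_rfl
  set J := ∫ r in Set.Ioi 0, h r with hJ
  have hJ0 : 0 ≤ J := setIntegral_nonneg measurableSet_Ioi fun r hr => hh0 r (le_of_lt hr)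
  -- On `D` one has `r > ρ`, so inserting `exp (K * (r - ρ)) ≥ 1` extracts the factor that later
  -- cancels `exp (K * ρ)`.
  have h1 : ∫ r in D, chiDensity m r ≤ Real.exp (-(K * ρ)) * ∫ r in D, h r := by
    rw [← integral_const_mul]
    refine setIntegral_mono_on (integrable_chiDensity m).integrableOn
      (hint.const_mul _).integrableOn hDm fun r hr => ?_
    have h2 : 1 ≤ Real.exp (-(K * ρ)) * Real.exp (K * r) := by
      rw [← Real.exp_add, Real.one_le_exp_iff]
      nlinarith [hr.1]
    calc chiDensity m r = chiDensity m r * 1 := (mul_one _).symm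
      _ ≤ chiDensity m r * (Real.exp (-(K * ρ)) * Real.exp (K * r)) :=
        mul_le_mul_of_nonneg_left h2 (chiDensity_nonneg m (hD0 hr).le)
      _ = _ := by simp only [hh]; ring
  have h3 : ∫ r in D, h r ≤ J := setIntegral_mono_set hint.integrableOn
    ((ae_restrict_iff' measurableSet_Ioi).2 (Eventually.of_forall fun r hr => hh0 r (le_of_lt hr)))
    hD0.eventuallyLE
  suffices h4 : ∫ r in D, h r ≤ s * (J + M) by
    calc _ ≤ _ := h1
      _ ≤ Real.exp (-(K * ρ)) * (s * (J + M)) := by gcongr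
      _ = _ := by ring
  rcases le_or_gt 1 s with hs1 | hs1
  · calc _ ≤ J := h3
      _ ≤ J + M := by linarith
      _ ≤ s * (J + M) := le_mul_of_one_le_left (by linarith) hs1
  · set ρ' := ρ / (1 - s) with hρ'
    have hs' : 0 < 1 - s := by linarith
    have hρs : ρ' * (1 - s) = ρ := by rw [hρ']; field_simp
    have hρ'0 : 0 < ρ' := by positivity
    have hDeq : D = Set.Ioc ρ ρ' := by
      ext r
      simp only [hD, Set.mem_ofPred_eq, Set.mem_Ioc, hρ', le_div_iff₀ hs']
      constructor <;> rintro ⟨h5, h6⟩ <;> exact ⟨h5, by linarith⟩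
    have hle : ρ ≤ ρ' := by nlinarith
    have h5 : ρ * ∫ r in D, h r ≤ (ρ' - ρ) * M := by
      rw [← integral_const_mul]
      calc ∫ r in D, ρ * h r ≤ ∫ r in D, M := by
            refine setIntegral_mono_on (hint.const_mul _).integrableOn ?_ hDm fun r hr => ?_
            · rw [hDeq]; exact integrableOn_const (by simp)
            · exact (mul_le_mul_of_nonneg_right hr.1.le (hh0 r (hD0 hr).le)).trans
                (hM r (hD0 hr).le)
        _ = _ := by rw [setIntegral_const, hDeq, Real.volume_real_Ioc_of_le hle, smul_eq_mul]
    have h6 : (ρ' - ρ) * ∫ r in D, h r ≤ (ρ' - ρ) * J := by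
      apply mul_le_mul_of_nonneg_left h3; linarith
    -- The interval has length `ρ' * s`. The pointwise bound `ρ * h ≤ M` controls `ρ` times the
    -- integral, the total mass `J` controls `ρ' - ρ` times it; the two bounds add up.
    have h7 : ρ' * ∫ r in D, h r ≤ ρ' * (s * (J + M)) := by
      have : ρ' - ρ = ρ' * s := by linarith
      rw [this] at h5 h6
      nlinarith
    exact le_of_mul_le_mul_left h7 hρ'0

end ChiDensity

/-! ### Stability of the χ-mass of convex sublevel sets. -/

section ConvexSublevel

lemma ConvexOn.le_of_mem_segment_zero {H : ℝ → ℝ} (hH : ConvexOn ℝ Set.univ H) {r ρ : ℝ}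
    (hρ : 0 ≤ ρ) (hr : ρ ≤ r) (hr0 : 0 < r) : r * H ρ ≤ (r - ρ) * H 0 + ρ * H r := by
  have h := hH.2 (Set.mem_univ 0) (Set.mem_univ r)
    (sub_nonneg.2 ((div_le_one hr0).2 hr)) (div_nonneg hρ hr0.le) (sub_add_cancel 1 (ρ / r))
  have e : (1 - ρ / r) • (0 : ℝ) + (ρ / r) • r = ρ := by
    simp only [smul_eq_mul]; field_simp; ring
  rw [e] at h
  simp only [smul_eq_mul] at h
  calc r * H ρ ≤ r * ((1 - ρ / r) * H 0 + ρ / r * H r) := by gcongr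
    _ = _ := by field_simp

lemma ConvexOn.setOf_nonneg_le_zero_eq_Icc {H : ℝ → ℝ} (hH : ConvexOn ℝ Set.univ H)
    (h0 : H 0 < 0) {ρ : ℝ} (hρ : 0 < ρ) (hHρ : H ρ = 0) :
    {r : ℝ | 0 ≤ r ∧ H r ≤ 0} = Set.Icc 0 ρ := by
  ext r
  simp only [Set.mem_ofPred_eq, Set.mem_Icc]
  refine and_congr_right fun hr => ⟨fun h => ?_, fun h => ?_⟩
  · by_contra! hlt
    have := hH.le_of_mem_segment_zero hρ.le hlt.le (hρ.trans hlt)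
    rw [hHρ] at this
    nlinarith
  · have := hH.le_of_mem_segment_zero hr h hρ
    rw [hHρ] at this
    by_contra! hpos
    nlinarith

lemma forall_le_zero_or_exists_eq_zero {H : ℝ → ℝ} (hc : Continuous H) (h0 : H 0 < 0) :
    (∀ r, 0 ≤ r → H r ≤ 0) ∨ ∃ ρ, 0 < ρ ∧ H ρ = 0 := by
  by_contra! hcon
  obtain ⟨⟨r, hr, hHr⟩, h⟩ := hcon
  obtain ⟨ρ, hρ, hHρ⟩ := intermediate_value_Icc hr hc.continuousOn ⟨h0.le, hHr.le⟩
  rcases hρ.1.eq_or_lt with rfl | hlt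
  · linarith
  · exact h ρ hlt hHρ

/-- A convex function that is nonpositive on the half-line stays below its initial value there. -/
lemma ConvexOn.le_apply_zero {H : ℝ → ℝ} (hH : ConvexOn ℝ Set.univ H)
    (hle : ∀ r, 0 ≤ r → H r ≤ 0) {r : ℝ} (hr : 0 ≤ r) : H r ≤ H 0 := by
  have key : ∀ R, r < R → R * (H r - H 0) ≤ r * (- H 0) := fun R hR => by
    have h1 := hH.le_of_mem_segment_zero hr hR.le (hr.trans_lt hR)
    have h2 := mul_nonpos_of_nonneg_of_nonpos hr (hle R (hr.trans hR.le))
    linarith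
  by_contra! hlt
  set δ := H r - H 0 with hδ
  have hδ0 : 0 < δ := by linarith
  -- `R` is chosen so large that `R * δ` exceeds `r * (- H 0)`.
  have h1 := key (r * (- H 0) / δ + r + 1) (by
    have : 0 ≤ r * (-H 0) / δ :=
      div_nonneg (mul_nonneg hr (by linarith [hle 0 le_rfl])) hδ0.le
    linarith)
  have h2 : (r * (- H 0) / δ + r + 1) * δ = r * (- H 0) + (r + 1) * δ := by field_simp; ring
  nlinarith

variable {m : ℕ}

lemma measurableSet_nonneg_le_zero {H : ℝ → ℝ} (hc : Continuous H) :
    MeasurableSet {r : ℝ | 0 ≤ r ∧ H r ≤ 0} :=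
  (measurableSet_le measurable_const measurable_id).inter
    (measurableSet_le hc.measurable measurable_const)

/-- Let `ρ` be a root of `H₁` and `r > ρ` feasible for `H₂`. Convexity of `H₂` on `[0, r]` with `H₂
0 ≤ -γ` gives `(r - ρ) γ ≤ -r H₂ ρ ≤ r d e^{Kρ}`, so `r` lies in the short interval of
`setIntegral_chiDensity_le`, whose factor `e^{-Kρ}` cancels. -/
lemma setIntegral_chiDensity_sublevel_sub_le {K M : ℝ} (hK : 0 ≤ K)
    (hM : ∀ r, 0 ≤ r → r * (chiDensity m r * Real.exp (K * r)) ≤ M) {H₁ H₂ : ℝ → ℝ} {γ d : ℝ}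
    (hγ : 0 < γ) (hd : 0 ≤ d) (h₁ : ConvexOn ℝ Set.univ H₁) (h₂ : ConvexOn ℝ Set.univ H₂)
    (hc₁ : Continuous H₁) (h₁0 : H₁ 0 ≤ -γ) (h₂0 : H₂ 0 ≤ -γ)
    (hdist : ∀ r, 0 ≤ r → H₁ r - H₂ r ≤ d * Real.exp (K * r)) :
    (∫ r in {r : ℝ | 0 ≤ r ∧ H₂ r ≤ 0}, chiDensity m r) -
      ∫ r in {r : ℝ | 0 ≤ r ∧ H₁ r ≤ 0}, chiDensity m r ≤
      d / γ * ((∫ r in Set.Ioi 0, chiDensity m r * Real.exp (K * r)) + M) := by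
  have hM0 : 0 ≤ M := by simpa using hM 0 le_rfl
  have hJ0 : 0 ≤ ∫ r in Set.Ioi 0, chiDensity m r * Real.exp (K * r) :=
    setIntegral_nonneg measurableSet_Ioi fun r hr =>
      mul_nonneg (chiDensity_nonneg m (le_of_lt hr)) (Real.exp_nonneg _)
  have hm₁ := measurableSet_nonneg_le_zero hc₁
  have hint : ∀ s, IntegrableOn (chiDensity m) s := fun s => (integrable_chiDensity m).integrableOn
  rcases forall_le_zero_or_exists_eq_zero hc₁ (by linarith) with hall | ⟨ρ, hρ, hHρ⟩
  · have hsub : {r : ℝ | 0 ≤ r ∧ H₂ r ≤ 0} ⊆ {r : ℝ | 0 ≤ r ∧ H₁ r ≤ 0} :=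
      fun r hr => ⟨hr.1, hall r hr.1⟩
    have : ∫ r in {r : ℝ | 0 ≤ r ∧ H₂ r ≤ 0}, chiDensity m r ≤
        ∫ r in {r : ℝ | 0 ≤ r ∧ H₁ r ≤ 0}, chiDensity m r :=
      setIntegral_mono_set (hint _) ((ae_restrict_iff' hm₁).2
        (Eventually.of_forall fun r hr => chiDensity_nonneg m hr.1)) hsub.eventuallyLE
    have h5 : 0 ≤ d / γ * ((∫ r in Set.Ioi 0, chiDensity m r * Real.exp (K * r)) + M) := by
      positivity
    linarith
  · set s := d * Real.exp (K * ρ) / γ with hs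
    set D : Set ℝ := {r | ρ < r ∧ r - ρ ≤ s * r} with hD
    have hDm : MeasurableSet D :=
      (measurableSet_lt measurable_const measurable_id).inter
        (measurableSet_le (f := fun r => r - ρ) (g := fun r => s * r) (by fun_prop) (by fun_prop))
    have hR₁ := h₁.setOf_nonneg_le_zero_eq_Icc (by linarith) hρ hHρ
    have hsub : {r : ℝ | 0 ≤ r ∧ H₂ r ≤ 0} ⊆ {r : ℝ | 0 ≤ r ∧ H₁ r ≤ 0} ∪ D := by
      rintro r ⟨hr0, hr⟩
      by_cases hrρ : r ≤ ρ
      · left; rw [hR₁]; exact ⟨hr0, hrρ⟩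
      · right
        push Not at hrρ
        have hr0' := hρ.trans hrρ
        refine ⟨hrρ, ?_⟩
        have h3 := h₂.le_of_mem_segment_zero hρ.le hrρ.le hr0'
        have h4 := hdist ρ hρ.le
        rw [hHρ] at h4
        have h5 : (r - ρ) * H₂ 0 ≤ (r - ρ) * (-γ) := by
          apply mul_le_mul_of_nonneg_left h₂0; linarith
        have h6 : ρ * H₂ r ≤ 0 := mul_nonpos_of_nonneg_of_nonpos hρ.le hr
        have h7 : r * (- H₂ ρ) ≤ r * (d * Real.exp (K * ρ)) := by
          apply mul_le_mul_of_nonneg_left _ hr0'.le; linarith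
        have h8 : (r - ρ) * γ ≤ r * (d * Real.exp (K * ρ)) := by linarith
        rw [hs, div_mul_eq_mul_div, le_div_iff₀ hγ]
        linarith
    have hnn : ∀ r ∈ {r : ℝ | 0 ≤ r ∧ H₁ r ≤ 0} ∪ D, 0 ≤ chiDensity m r := by
      rintro r (hr | hr)
      · exact chiDensity_nonneg m hr.1
      · exact chiDensity_nonneg m (hρ.trans hr.1).le
    have hdisj : Disjoint {r : ℝ | 0 ≤ r ∧ H₁ r ≤ 0} D := by
      rw [hR₁, Set.disjoint_left]
      exact fun r hr hr' => absurd hr.2 (not_le.2 hr'.1)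
    have h9 : ∫ r in {r : ℝ | 0 ≤ r ∧ H₂ r ≤ 0}, chiDensity m r ≤
        (∫ r in {r : ℝ | 0 ≤ r ∧ H₁ r ≤ 0}, chiDensity m r) + ∫ r in D, chiDensity m r := by
      rw [← setIntegral_union hdisj hDm (hint _) (hint _)]
      exact setIntegral_mono_set (hint _) ((ae_restrict_iff' (hm₁.union hDm)).2
        (Eventually.of_forall hnn)) hsub.eventuallyLE
    have h10 := setIntegral_chiDensity_le hK hM hρ (s := s) (by positivity)
    have h11 : Real.exp (-(K * ρ)) * s = d / γ := by
      rw [hs, Real.exp_neg]; field_simp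
    rw [h11] at h10
    linarith

/-- Lipschitz dependence of the `χ`-mass of the sublevel set on the convex function. -/
lemma abs_setIntegral_chiDensity_sublevel_sub_le {K M : ℝ} (hK : 0 ≤ K)
    (hM : ∀ r, 0 ≤ r → r * (chiDensity m r * Real.exp (K * r)) ≤ M) {H₁ H₂ : ℝ → ℝ} {γ d : ℝ}
    (hγ : 0 < γ) (hd : 0 ≤ d) (h₁ : ConvexOn ℝ Set.univ H₁) (h₂ : ConvexOn ℝ Set.univ H₂)
    (hc₁ : Continuous H₁) (hc₂ : Continuous H₂) (h₁0 : H₁ 0 ≤ -γ) (h₂0 : H₂ 0 ≤ -γ)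
    (hdist : ∀ r, 0 ≤ r → |H₁ r - H₂ r| ≤ d * Real.exp (K * r)) :
    |(∫ r in {r : ℝ | 0 ≤ r ∧ H₁ r ≤ 0}, chiDensity m r) -
      ∫ r in {r : ℝ | 0 ≤ r ∧ H₂ r ≤ 0}, chiDensity m r| ≤
      d / γ * ((∫ r in Set.Ioi 0, chiDensity m r * Real.exp (K * r)) + M) := by
  rw [abs_sub_le_iff]
  exact ⟨setIntegral_chiDensity_sublevel_sub_le hK hM hγ hd h₂ h₁ hc₂ h₂0 h₁0 fun r hr =>
      (neg_sub (H₁ r) (H₂ r)) ▸ (neg_le_abs _).trans (hdist r hr),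
    setIntegral_chiDensity_sublevel_sub_le hK hM hγ hd h₁ h₂ hc₁ h₁0 h₂0 fun r hr =>
      (le_abs_self _).trans (hdist r hr)⟩

/-- Quadratic dependence near a convex function whose sublevel set is the whole half-line. -/
lemma abs_setIntegral_chiDensity_sublevel_sub_le_sq {K : ℝ} {H₁ H₂ : ℝ → ℝ} {γ d : ℝ}
    (hγ : 0 < γ) (h₁ : ConvexOn ℝ Set.univ H₁)
    (hc₂ : Continuous H₂) (h₁0 : H₁ 0 ≤ -γ) (hall : ∀ r, 0 ≤ r → H₁ r ≤ 0)
    (hdist : ∀ r, 0 ≤ r → |H₂ r - H₁ r| ≤ d * Real.exp (K * r)) :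
    |(∫ r in {r : ℝ | 0 ≤ r ∧ H₂ r ≤ 0}, chiDensity m r) -
      ∫ r in {r : ℝ | 0 ≤ r ∧ H₁ r ≤ 0}, chiDensity m r| ≤
      (d / γ) ^ 2 * ∫ r in Set.Ici 0, chiDensity m r * Real.exp (2 * K * r) := by
  have hR₁ : {r : ℝ | 0 ≤ r ∧ H₁ r ≤ 0} = Set.Ici 0 := by
    ext r; exact ⟨fun h => h.1, fun h => ⟨h, hall r h⟩⟩
  have hm₂ := measurableSet_nonneg_le_zero hc₂
  set R := {r : ℝ | 0 ≤ r ∧ H₂ r ≤ 0} with hR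
  have hsub : R ⊆ Set.Ici 0 := fun r hr => hr.1
  have hint : ∀ s, IntegrableOn (chiDensity m) s := fun s => (integrable_chiDensity m).integrableOn
  have hint' : Integrable fun r => (d / γ) ^ 2 * (chiDensity m r * Real.exp (2 * K * r)) :=
    (integrable_chiDensity_mul_exp m (2 * K)).const_mul _
  have hmD : MeasurableSet (Set.Ici 0 \ R) := measurableSet_Ici.diff hm₂
  rw [hR₁, abs_sub_comm, ← setIntegral_sdiff hm₂ (hint _) hsub, abs_of_nonneg
    (setIntegral_nonneg hmD fun r hr => chiDensity_nonneg m hr.1), ← integral_const_mul]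
  calc ∫ r in Set.Ici 0 \ R, chiDensity m r
      ≤ ∫ r in Set.Ici 0 \ R, (d / γ) ^ 2 * (chiDensity m r * Real.exp (2 * K * r)) := by
        refine setIntegral_mono_on (hint _) hint'.integrableOn hmD fun r hr => ?_
        have hr0 : 0 ≤ r := hr.1
        have h3 : 0 < H₂ r := by
          by_contra! h
          exact hr.2 ⟨hr0, h⟩
        have h4 := (le_abs_self _).trans (hdist r hr0)
        have h5 := h₁.le_apply_zero hall hr0
        have h6 : γ ≤ d * Real.exp (K * r) := by linarith
        have h7 : 1 ≤ d / γ * Real.exp (K * r) := by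
          rw [div_mul_eq_mul_div, one_le_div hγ]; exact h6
        -- A Chebyshev bound: on the lost radii the perturbation exceeds `γ`, and squaring the ratio
        -- produces the second order in `d`.
        have h8 : 1 ≤ (d / γ * Real.exp (K * r)) ^ 2 := one_le_pow₀ h7
        have h9 : Real.exp (2 * K * r) = Real.exp (K * r) ^ 2 := by
          rw [← Real.exp_nat_mul]; congr 1; push_cast; ring
        calc chiDensity m r = chiDensity m r * 1 := (mul_one _).symm
          _ ≤ chiDensity m r * (d / γ * Real.exp (K * r)) ^ 2 :=
            mul_le_mul_of_nonneg_left h8 (chiDensity_nonneg m hr0)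
          _ = _ := by rw [h9]; ring
    _ ≤ _ := setIntegral_mono_set hint'.integrableOn ((ae_restrict_iff' measurableSet_Ici).2
        (Eventually.of_forall fun r hr => mul_nonneg (sq_nonneg _)
          (mul_nonneg (chiDensity_nonneg m hr) (Real.exp_nonneg _))))
        Set.sdiff_subset.eventuallyLE

end ConvexSublevel

/-! ### Differentiability and uniform Lipschitz bounds of the radial functions. -/

section RadialProbability

/-- The `χ`-mass of the sublevel sets of a `C¹` family of functions, convex along the half-line, is
differentiable where the sublevel set is a bounded interval. -/
lemma differentiableAt_setIntegral_chiDensity_sublevel {E : Type*} [NormedAddCommGroup E]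
    [NormedSpace ℝ E] [CompleteSpace E] {m : ℕ} {H : E → ℝ → ℝ}
    (hH : ContDiff ℝ 1 fun q : E × ℝ => H q.1 q.2) (hconv : ∀ y, ConvexOn ℝ Set.univ (H y))
    {x₀ : E} {ρ : ℝ} (h0 : H x₀ 0 < 0) (hρ : 0 < ρ) (hHρ : H x₀ ρ = 0) :
    DifferentiableAt ℝ (fun y => ∫ r in {r : ℝ | 0 ≤ r ∧ H y r ≤ 0}, chiDensity m r) x₀ := by
  have hcont := hH.continuous
  set f : E × ℝ → ℝ := fun q => H q.1 q.2 with hf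
  have cdf : ContDiffAt ℝ 1 f (x₀, ρ) := hH.contDiffAt
  have hd : HasFDerivAt f (fderiv ℝ f (x₀, ρ)) (x₀, ρ) :=
    (cdf.differentiableAt one_ne_zero).hasFDerivAt
  have hline : HasDerivAt (H x₀) (fderiv ℝ f (x₀, ρ) (0, 1)) ρ :=
    HasFDerivAt.comp_hasDerivAt (f := fun r : ℝ => (x₀, r)) ρ hd
      ((hasDerivAt_const ρ x₀).prodMk (hasDerivAt_id ρ))
  -- By convexity the derivative at `ρ` is at least the chord slope `-H x₀ 0 / ρ > 0`, so the root
  -- is transversal.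
  have hpos : 0 < fderiv ℝ f (x₀, ρ) (0, 1) := by
    have h := (hconv x₀).slope_le_of_hasDerivAt (Set.mem_univ 0) (Set.mem_univ ρ) hρ hline
    rw [slope_def_field, hHρ] at h
    refine lt_of_lt_of_le ?_ h
    apply div_pos <;> linarith
  have hinv : (fderiv ℝ f (x₀, ρ) ∘L .inr ℝ E ℝ).IsInvertible := by
    refine ⟨ContinuousLinearEquiv.unitsEquivAut ℝ (Units.mk0 _ hpos.ne'), ?_⟩
    ext
    simp
  set ψ := cdf.implicitFunction one_ne_zero hinv with hψ
  have hψ0 : ψ x₀ = ρ := cdf.implicitFunction_apply_self one_ne_zero hinv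
  have hψd : DifferentiableAt ℝ ψ x₀ :=
    (cdf.hasStrictFDerivAt_implicitFunction one_ne_zero hinv).hasFDerivAt.differentiableAt
  have hev : ∀ᶠ y in 𝓝 x₀, H y (ψ y) = 0 := by
    have h := cdf.eventually_apply_implicitFunction one_ne_zero hinv
    filter_upwards [h] with y hy
    exact hy.trans hHρ
  have hψpos : ∀ᶠ y in 𝓝 x₀, 0 < ψ y := by
    refine hψd.continuousAt.eventually_const_lt ?_
    rwa [hψ0]
  have hneg : ∀ᶠ y in 𝓝 x₀, H y 0 < 0 := by
    have : Continuous fun y => H y 0 :=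
      hcont.comp (by fun_prop : Continuous fun y : E => (y, (0 : ℝ)))
    exact this.continuousAt.eventually_lt_const h0
  have heq : (fun y => ∫ r in {r : ℝ | 0 ≤ r ∧ H y r ≤ 0}, chiDensity m r) =ᶠ[𝓝 x₀]
      fun y => ∫ r in (0 : ℝ)..ψ y, chiDensity m r := by
    filter_upwards [hev, hψpos, hneg] with y h1 h2 h3
    rw [(hconv y).setOf_nonneg_le_zero_eq_Icc h3 h2 h1, integral_Icc_eq_integral_Ioc,
      intervalIntegral.integral_of_le h2.le]
  refine DifferentiableAt.congr_of_eventuallyEq ?_ heq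
  have hprim : DifferentiableAt ℝ (fun u => ∫ r in (0 : ℝ)..u, chiDensity m r) (ψ x₀) :=
    ((continuous_chiDensity m).integral_hasStrictDerivAt 0 (ψ x₀)).hasDerivAt.differentiableAt
  exact hprim.comp x₀ hψd

namespace GaussianMixture

variable {m n p : ℕ} (G : GaussianMixture m p) {g : Eucl n → Eucl m → ℝ}

/-- The point at distance parameter `r` on the ray in direction `v`. -/
def ray (c : G.params) (v : Eucl m) (r : ℝ) : Eucl m :=
  r • Matrix.toEuclideanCLM (n := Fin m) (𝕜 := ℝ) (G.chol c) v + G.mean c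

lemma continuous_ray (c : G.params) (v : Eucl m) : Continuous (G.ray c v) := by
  unfold ray; fun_prop

lemma contDiff_ray (c : G.params) (v : Eucl m) : ContDiff ℝ 1 (G.ray c v) := by
  unfold ray; fun_prop

lemma radialProb_eq (c : G.params) (x : Eucl n) (v : USphere m) :
    G.radialProb g c x v = ∫ r in {r : ℝ | 0 ≤ r ∧ g x (G.ray c v r) ≤ 0}, chiDensity m r := rfl

lemma convexOn_comp_ray (hconv : ∀ x, ConvexOn ℝ Set.univ (g x)) (c : G.params) (v : Eucl m)
    (x : Eucl n) : ConvexOn ℝ Set.univ fun r => g x (G.ray c v r) := by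
  refine ⟨convex_univ, fun r _ s _ a b ha hb hab => ?_⟩
  have h : G.ray c v (a • r + b • s) = a • G.ray c v r + b • G.ray c v s := by
    have hb' : b = 1 - a := by linarith
    subst hb'
    simp only [ray, smul_eq_mul]
    module
  simp only [h]
  exact (hconv x).2 (Set.mem_univ _) (Set.mem_univ _) ha hb hab

lemma norm_ray_le {η₀ : ℝ}
    (hη : ∀ c, ‖G.mean c‖ + ‖Matrix.toEuclideanCLM (n := Fin m) (𝕜 := ℝ) (G.chol c)‖ ≤ η₀)
    (c : G.params) (v : USphere m) {r : ℝ} (hr : 0 ≤ r) : ‖G.ray c v r‖ ≤ η₀ * (1 + r) := by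
  have h1 := hη c
  have hm := norm_nonneg (G.mean c)
  have hL := norm_nonneg (Matrix.toEuclideanCLM (n := Fin m) (𝕜 := ℝ) (G.chol c))
  have hv : ‖(v : Eucl m)‖ = 1 := by simp
  have h2 : ‖Matrix.toEuclideanCLM (n := Fin m) (𝕜 := ℝ) (G.chol c) (v : Eucl m)‖ ≤ η₀ := by
    have := (Matrix.toEuclideanCLM (n := Fin m) (𝕜 := ℝ) (G.chol c)).le_opNorm (v : Eucl m)
    rw [hv, mul_one] at this
    linarith
  calc ‖G.ray c v r‖ ≤ ‖r • Matrix.toEuclideanCLM (n := Fin m) (𝕜 := ℝ) (G.chol c) (v : Eucl m)‖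
        + ‖G.mean c‖ := norm_add_le _ _
    _ = r * ‖Matrix.toEuclideanCLM (n := Fin m) (𝕜 := ℝ) (G.chol c) (v : Eucl m)‖ + ‖G.mean c‖ := by
        rw [norm_smul, Real.norm_of_nonneg hr]
    _ ≤ r * η₀ + η₀ := by gcongr; linarith
    _ = _ := by ring

lemma norm_fderiv_eq_norm_gradient {F : Eucl n → ℝ} (x : Eucl n) : ‖fderiv ℝ F x‖ = ‖∇ F x‖ := by
  rw [← toDual_gradient, LinearIsometryEquiv.norm_map]

/-- Local uniform control of `g` along the rays near a uniform Slater point. -/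
lemma exists_ball_forall_abs_sub_le (hg : ContDiff ℝ 1 (fun q : Eucl n × Eucl m => g q.1 q.2))
    {x₀ : Eucl n} (hS : G.IsUniformSlaterPoint g x₀) (hexp : ExponentialGrowthAt g x₀) :
    ∃ δ γ d K : ℝ, 0 < δ ∧ 0 < γ ∧ 0 ≤ d ∧ 0 ≤ K ∧
      (∀ y ∈ Metric.ball x₀ δ, ∀ c, g y (G.mean c) ≤ -γ) ∧
      ∀ y ∈ Metric.ball x₀ δ, ∀ c (v : USphere m) (r : ℝ), 0 ≤ r →
        |g y (G.ray c v r) - g x₀ (G.ray c v r)| ≤ d * ‖y - x₀‖ * Real.exp (K * r) := by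
  obtain ⟨U, hU, hxU, γ, hγ, hUγ⟩ := hS
  obtain ⟨ε, a, b, hε, ha, hb, hgrad⟩ := hexp
  obtain ⟨η₀, hη₀, hη⟩ := G.bounded
  obtain ⟨δ', hδ', hball⟩ := Metric.isOpen_iff.1 hU x₀ hxU
  have hxm : x₀ ∈ Metric.ball x₀ (min ε δ') := Metric.mem_ball_self (lt_min hε hδ')
  -- The constants come from the growth bound with `‖z‖ ≤ η₀ * (1 + r)` on rays, split as `e^{bη₀}
  -- e^{bη₀ r}`.
  refine ⟨min ε δ', γ, a * Real.exp (b * η₀), b * η₀, lt_min hε hδ', hγ, by positivity,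
    by positivity, fun y hy c =>
      (hUγ y (hball (Metric.ball_subset_ball (min_le_right _ _) hy)) c).le,
    fun y hy c v r hr => ?_⟩
  set z := G.ray c v r with hz
  have hz' : ‖z‖ ≤ η₀ * (1 + r) := G.norm_ray_le hη c v hr
  have hdiff : Differentiable ℝ fun y => g y z :=
    (hg.comp (by fun_prop : ContDiff ℝ 1 fun y : Eucl n => (y, z))).differentiable one_ne_zero
  have h := (convex_ball x₀ (min ε δ')).norm_image_sub_le_of_norm_fderiv_le (𝕜 := ℝ)
    (f := fun y => g y z) (C := a * Real.exp (b * ‖z‖)) (fun y _ => hdiff y) (fun y hy => by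
      rw [norm_fderiv_eq_norm_gradient]
      exact hgrad y (Metric.ball_subset_ball (min_le_left _ _) hy) z) hxm hy
  calc |g y z - g x₀ z| ≤ a * Real.exp (b * ‖z‖) * ‖y - x₀‖ := h
    _ ≤ a * Real.exp (b * (η₀ * (1 + r))) * ‖y - x₀‖ := by gcongr
    _ = _ := by
      rw [show b * (η₀ * (1 + r)) = b * η₀ + b * η₀ * r by ring, Real.exp_add]; ring

lemma continuous_comp_ray (hg : ContDiff ℝ 1 (fun q : Eucl n × Eucl m => g q.1 q.2))
    (c : G.params) (v : Eucl m) (x : Eucl n) : Continuous fun r => g x (G.ray c v r) :=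
  hg.continuous.comp (continuous_const.prodMk (G.continuous_ray c v))

lemma ray_zero (c : G.params) (v : Eucl m) : G.ray c v 0 = G.mean c := by simp [ray]

/-- The radial probability functions are Lipschitz at a uniform Slater point, uniformly in the
direction and the parameter. -/
lemma exists_forall_abs_radialProb_sub_le
    (hg : ContDiff ℝ 1 (fun q : Eucl n × Eucl m => g q.1 q.2))
    (hconv : ∀ x, ConvexOn ℝ Set.univ (g x))
    {x₀ : Eucl n} (hS : G.IsUniformSlaterPoint g x₀) (hexp : ExponentialGrowthAt g x₀) :
    ∃ δ C : ℝ, 0 < δ ∧ 0 ≤ C ∧ ∀ y ∈ Metric.ball x₀ δ, ∀ c (v : USphere m),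
      |G.radialProb g c y v - G.radialProb g c x₀ v| ≤ C * ‖y - x₀‖ := by
  obtain ⟨δ, γ, d, K, hδ, hγ, hd, hK, hslater, hlip⟩ := G.exists_ball_forall_abs_sub_le hg hS hexp
  obtain ⟨M, hM0, hM⟩ := exists_mul_chiDensity_mul_exp_le m K
  have hJ0 : 0 ≤ ∫ r in Set.Ioi 0, chiDensity m r * Real.exp (K * r) :=
    setIntegral_nonneg measurableSet_Ioi fun r hr =>
      mul_nonneg (chiDensity_nonneg m (le_of_lt hr)) (Real.exp_nonneg _)
  refine ⟨δ, d / γ * ((∫ r in Set.Ioi 0, chiDensity m r * Real.exp (K * r)) + M), hδ, by positivity,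
    fun y hy c v => ?_⟩
  have h := abs_setIntegral_chiDensity_sublevel_sub_le hK hM hγ (d := d * ‖y - x₀‖) (by positivity)
    (G.convexOn_comp_ray hconv c v y) (G.convexOn_comp_ray hconv c v x₀)
    (G.continuous_comp_ray hg c v y) (G.continuous_comp_ray hg c v x₀)
    (by rw [ray_zero]; exact hslater y hy c)
    (by rw [ray_zero]; exact hslater x₀ (Metric.mem_ball_self hδ) c) (hlip y hy c v)
  rw [radialProb_eq, radialProb_eq]
  refine h.trans (le_of_eq ?_)
  ring

/-- If the ray never leaves the feasible set, the increment is `O(‖y - x₀‖²)`; otherwise the exit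
radius is an implicit function. -/
lemma differentiableAt_radialProb (hg : ContDiff ℝ 1 (fun q : Eucl n × Eucl m => g q.1 q.2))
    (hconv : ∀ x, ConvexOn ℝ Set.univ (g x))
    {x₀ : Eucl n} (hS : G.IsUniformSlaterPoint g x₀) (hexp : ExponentialGrowthAt g x₀)
    (c : G.params) (v : USphere m) :
    DifferentiableAt ℝ (fun y => G.radialProb g c y v) x₀ := by
  obtain ⟨δ, γ, d, K, hδ, hγ, hd, hK, hslater, hlip⟩ := G.exists_ball_forall_abs_sub_le hg hS hexp
  have h0 : g x₀ (G.ray c v 0) ≤ -γ := by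
    rw [ray_zero]; exact hslater x₀ (Metric.mem_ball_self hδ) c
  rcases forall_le_zero_or_exists_eq_zero (G.continuous_comp_ray hg c v x₀) (by linarith) with
    hall | ⟨ρ, hρ, hHρ⟩
  · set J := ∫ r in Set.Ici 0, chiDensity m r * Real.exp (2 * K * r) with hJ
    have hO : (fun y => G.radialProb g c y v - G.radialProb g c x₀ v) =O[𝓝 x₀]
        fun y => ‖y - x₀‖ ^ 2 := by
      refine Asymptotics.IsBigO.of_bound ((d / γ) ^ 2 * J) ?_
      filter_upwards [Metric.ball_mem_nhds x₀ hδ] with y hy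
      have h := abs_setIntegral_chiDensity_sublevel_sub_le_sq (m := m) hγ
        (d := d * ‖y - x₀‖) (K := K)
        (G.convexOn_comp_ray hconv c v x₀) (G.continuous_comp_ray hg c v y) h0 hall
        (hlip y hy c v)
      rw [norm_pow, norm_norm, Real.norm_eq_abs, radialProb_eq, radialProb_eq]
      refine h.trans (le_of_eq ?_)
      ring
    have := (hO.hasFDerivAt (𝕜 := ℝ) one_lt_two).differentiableAt.add_const
      (c := G.radialProb g c x₀ v)
    simpa using this
  · refine differentiableAt_setIntegral_chiDensity_sublevel
      (H := fun y r => g y (G.ray c v r)) ?_ (G.convexOn_comp_ray hconv c v) (by linarith) hρ hHρ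
    exact hg.comp (contDiff_fst.prodMk ((G.contDiff_ray c v).comp contDiff_snd))

lemma abs_radialProb_le (hg : Continuous (fun q : Eucl n × Eucl m => g q.1 q.2)) (c : G.params)
    (x : Eucl n) (v : USphere m) :
    |G.radialProb g c x v| ≤ ∫ r in Set.Ici 0, chiDensity m r := by
  have hc : Continuous fun r => g x (G.ray c v r) :=
    hg.comp (continuous_const.prodMk (G.continuous_ray c v))
  rw [radialProb_eq, abs_of_nonneg (setIntegral_nonneg (measurableSet_nonneg_le_zero hc)
    fun r hr => chiDensity_nonneg m hr.1)]
  refine setIntegral_mono_set (integrable_chiDensity m).integrableOn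
    ((ae_restrict_iff' measurableSet_Ici).2 (Eventually.of_forall fun r hr =>
      chiDensity_nonneg m hr)) (Eventually.of_forall fun r hr => hr.1)

lemma measurable_ray : Measurable fun q : (USphere m × G.params) × ℝ => G.ray q.1.2 q.1.1 q.2 := by
  have hL : Measurable fun q : (USphere m × G.params) × ℝ =>
      Matrix.toEuclideanCLM (n := Fin m) (𝕜 := ℝ) (G.chol q.1.2) (q.1.1 : Eucl m) := by
    refine (MeasurableEquiv.toLp 2 (Fin m → ℝ)).measurable.comp
      (f := fun q : (USphere m × G.params) × ℝ => G.chol q.1.2 *ᵥ (q.1.1 : Eucl m).ofLp)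
      (measurable_pi_lambda _ fun i => ?_)
    change Measurable fun q : (USphere m × G.params) × ℝ =>
      ∑ j, G.chol q.1.2 i j * (q.1.1 : Eucl m).ofLp j
    refine Finset.measurable_sum _ fun j _ => ?_
    have h1 := G.measurable_chol i j
    have h2 : Measurable fun v : USphere m => (v : Eucl m).ofLp j := by fun_prop
    exact (h1.comp (measurable_snd.comp measurable_fst)).mul
      (h2.comp (measurable_fst.comp measurable_fst))
  have hmean := G.measurable_mean
  unfold ray
  fun_prop

lemma measurable_radialProb (hg : Continuous (fun q : Eucl n × Eucl m => g q.1 q.2)) (x : Eucl n) :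
    Measurable fun q : USphere m × G.params => G.radialProb g q.2 x q.1 := by
  have hgx : Measurable (g x) := (hg.comp (Continuous.prodMk_right x)).measurable
  have hset : MeasurableSet {q : (USphere m × G.params) × ℝ |
      0 ≤ q.2 ∧ g x (G.ray q.1.2 q.1.1 q.2) ≤ 0} :=
    (measurableSet_le measurable_const measurable_snd).inter
      (measurableSet_le (hgx.comp G.measurable_ray) measurable_const)
  have hm : StronglyMeasurable ({q : (USphere m × G.params) × ℝ |
      0 ≤ q.2 ∧ g x (G.ray q.1.2 q.1.1 q.2) ≤ 0}.indicator fun q => chiDensity m q.2) :=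
    (((continuous_chiDensity m).measurable.comp measurable_snd).indicator hset).stronglyMeasurable
  have h := hm.integral_prod_right' (ν := (volume : Measure ℝ))
  convert h.measurable using 2 with q
  rw [radialProb_eq, ← integral_indicator]
  · rfl
  · exact measurableSet_nonneg_le_zero
      (hg.comp (continuous_const.prodMk (G.continuous_ray q.2 q.1)))

end GaussianMixture

end RadialProbability

/-! ### Polar coordinates and the normalising constant. -/

section Polar

/-- Integration in polar coordinates. -/
lemma integral_eq_integral_toSphere {E : Type*} [NormedAddCommGroup E] [NormedSpace ℝ E]
    [MeasurableSpace E] [BorelSpace E] [FiniteDimensional ℝ E] [Nontrivial E] (μ : Measure E)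
    [μ.IsAddHaarMeasure] {F : E → ℝ} (hF : Integrable F μ) :
    ∫ x, F x ∂μ = ∫ v : Metric.sphere (0 : E) 1, (∫ r in Set.Ioi (0 : ℝ),
      r ^ (Module.finrank ℝ E - 1) * F (r • (v : E))) ∂μ.toSphere := by
  set k : Metric.sphere (0 : E) 1 × Set.Ioi (0 : ℝ) → ℝ := fun q => F (q.2.1 • (q.1 : E)) with hk
  have hemb : MeasurableEmbedding (homeomorphUnitSphereProd E) :=
    (homeomorphUnitSphereProd E).measurableEmbedding
  have hcomp : k ∘ homeomorphUnitSphereProd E = fun x : ({0}ᶜ : Set E) => F x := by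
    ext x
    have hx : ‖(x : E)‖ ≠ 0 := norm_ne_zero_iff.2 x.2
    simp [hk, smul_smul, hx]
  have hmp := μ.measurePreserving_homeomorphUnitSphereProd
  have hF' : Integrable (fun x : ({0}ᶜ : Set E) => F x) (μ.comap (↑)) := by
    have h := (integrableOn_iff_comap_subtypeVal (f := F) (s := ({0}ᶜ : Set E)) (μ := μ)
      (measurableSet_singleton _).compl).1 hF.integrableOn
    exact h
  have hki : Integrable k (μ.toSphere.prod (Measure.volumeIoiPow (Module.finrank ℝ E - 1))) := by
    rw [← hmp.integrable_comp_emb hemb, hcomp]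
    exact hF'
  calc ∫ x, F x ∂μ = ∫ x : ({0}ᶜ : Set E), F x ∂(μ.comap (↑)) := by
        rw [integral_subtype_comap (measurableSet_singleton _).compl F,
          restrict_compl_singleton]
    _ = ∫ q, k q ∂μ.toSphere.prod (Measure.volumeIoiPow (Module.finrank ℝ E - 1)) := by
        rw [← hmp.integral_comp hemb]
        exact integral_congr_ae (Eventually.of_forall fun x => (congrFun hcomp x).symm)
    _ = ∫ v, ∫ r, k (v, r) ∂Measure.volumeIoiPow (Module.finrank ℝ E - 1) ∂μ.toSphere :=
        integral_prod _ hki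
    _ = _ := by
      refine integral_congr_ae (Eventually.of_forall fun v => ?_)
      simp only [Measure.volumeIoiPow, ENNReal.ofReal, hk]
      rw [integral_withDensity_eq_integral_smul,
        integral_subtype_comap measurableSet_Ioi fun a =>
          Real.toNNReal (a ^ (Module.finrank ℝ E - 1)) • F (a • (v : E))]
      · refine setIntegral_congr_fun measurableSet_Ioi fun r hr => ?_
        simp only [NNReal.smul_def, smul_eq_mul]
        rw [Real.coe_toNNReal _ (pow_nonneg (le_of_lt hr) _)]
      · exact (measurable_subtype_coe.pow_const _).real_toNNReal

/-- The sphere has area `2 π^{m/2} / Γ(m/2)`; multiplied by the Gaussian constant this is the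
normalisation of `chiDensity`. -/
lemma toSphere_real_univ_mul_gaussian {m : ℕ} (hm : 0 < m) :
    ((volume : Measure (Eucl m)).toSphere Set.univ).toReal * (1 / √((2 * Real.pi) ^ m)) =
      (2 : ℝ) ^ (1 - (m : ℝ) / 2) / Real.Gamma ((m : ℝ) / 2) := by
  have : Nonempty (Fin m) := ⟨⟨0, hm⟩⟩
  have hm' : (0 : ℝ) < m := by exact_mod_cast hm
  have hΓ : 0 < Real.Gamma ((m : ℝ) / 2) := Real.Gamma_pos_of_pos (by positivity)
  have hs : √Real.pi ^ m / Real.Gamma ((m : ℝ) / 2 + 1) ≥ 0 := by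
    rw [Real.Gamma_add_one (by positivity)]; positivity
  rw [Measure.toSphere_apply_univ, EuclideanSpace.volume_ball, ENNReal.ofReal_one, one_pow, one_mul,
    finrank_euclideanSpace, Fintype.card_fin, ENNReal.toReal_mul, ENNReal.toReal_natCast,
    ENNReal.toReal_ofReal hs, Real.Gamma_add_one (by positivity), mul_pow,
    Real.sqrt_mul (by positivity), Real.rpow_sub two_pos, Real.rpow_one,
    Real.sqrt_eq_rpow (2 ^ m), Real.sqrt_eq_rpow (Real.pi ^ m), Real.sqrt_eq_rpow Real.pi,
    ← Real.rpow_natCast, ← Real.rpow_natCast, ← Real.rpow_natCast, ← Real.rpow_mul two_pos.le,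
    ← Real.rpow_mul Real.pi_pos.le, ← Real.rpow_mul Real.pi_pos.le,
    show (1 : ℝ) / 2 * m = m / 2 by ring, show (m : ℝ) * (1 / 2) = m / 2 by ring]
  have h1 : (0 : ℝ) < Real.pi ^ ((m : ℝ) / 2) := Real.rpow_pos_of_pos Real.pi_pos _
  have h2 : (0 : ℝ) < 2 ^ ((m : ℝ) / 2) := Real.rpow_pos_of_pos two_pos _
  field_simp

instance isProbabilityMeasure_uniformSphere {m : ℕ} [NeZero m] :
    IsProbabilityMeasure (uniformSphere m) := by
  have : Nontrivial (Eucl m) := by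
    have : Nonempty (Fin m) := ⟨0⟩
    infer_instance
  constructor
  rw [uniformSphere, Measure.smul_apply, smul_eq_mul]
  refine ENNReal.inv_mul_cancel ?_ (measure_ne_top _ _)
  rw [ne_eq, Measure.measure_univ_eq_zero]
  exact Measure.toSphere_ne_zero _

end Polar

/-! ### Spheric-radial decomposition of the conditional probability. -/

namespace GaussianMixture

variable {m n p : ℕ} (G : GaussianMixture m p) {g : Eucl n → Eucl m → ℝ}

lemma det_chol_pos (c : G.params) : 0 < (G.chol c).det := by
  rw [Matrix.det_of_isLowerTriangular _ (fun i j hij => G.chol_lower c i j hij)]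
  exact Finset.prod_pos fun i _ => G.chol_diag_pos c i

/-- The inverse covariance turns the quadratic form into `‖y‖²`; the inverse determinant will cancel
against the Jacobian. -/
lemma density_affine (c : G.params) (y : Eucl m) :
    G.density c (Matrix.toEuclideanCLM (n := Fin m) (𝕜 := ℝ) (G.chol c) y + G.mean c) =
      ((G.chol c).det)⁻¹ * (1 / √((2 * Real.pi) ^ m) * Real.exp (-‖y‖ ^ 2 / 2)) := by
  have hdet := G.det_chol_pos c
  set A := G.chol c with hA
  have hAu : IsUnit A.det := isUnit_iff_ne_zero.2 hdet.ne'
  have hq : (A *ᵥ y.ofLp) ⬝ᵥ ((G.cov c)⁻¹ *ᵥ (A *ᵥ y.ofLp)) = ‖y‖ ^ 2 := by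
    have h1 : (G.cov c)⁻¹ *ᵥ (A *ᵥ y.ofLp) = (Aᵀ)⁻¹ *ᵥ y.ofLp := by
      rw [cov, ← hA, Matrix.mul_inv_rev, Matrix.mulVec_mulVec, Matrix.mul_assoc,
        Matrix.nonsing_inv_mul _ hAu, Matrix.mul_one]
    rw [h1, Matrix.dotProduct_mulVec, ← Matrix.mulVec_transpose, Matrix.transpose_nonsing_inv,
      Matrix.transpose_transpose, Matrix.mulVec_mulVec, Matrix.nonsing_inv_mul _ hAu,
      Matrix.one_mulVec, EuclideanSpace.real_norm_sq_eq]
    simp [dotProduct, sq]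
  have hs : √((2 * Real.pi) ^ m * (G.cov c).det) = √((2 * Real.pi) ^ m) * A.det := by
    rw [cov, ← hA, Matrix.det_mul, Matrix.det_transpose, Real.sqrt_mul (by positivity),
      Real.sqrt_mul_self hdet.le]
  rw [density, add_sub_cancel_right, Matrix.ofLp_toEuclideanCLM, hq, hs,
    show -(1 / 2) * ‖y‖ ^ 2 = -‖y‖ ^ 2 / 2 by ring]
  field_simp

lemma continuous_density (c : G.params) : Continuous (G.density c) := by
  unfold density
  fun_prop

lemma condProb_eq_integral (hg : Continuous (fun q : Eucl n × Eucl m => g q.1 q.2)) (c : G.params)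
    (x : Eucl n) : G.condProb g c x = ∫ y : Eucl m, {y : Eucl m | g x (G.ray c y 1) ≤ 0}.indicator
      (fun y => 1 / √((2 * Real.pi) ^ m) * Real.exp (-‖y‖ ^ 2 / 2)) y := by
  have hdet := G.det_chol_pos c
  have hgx : Continuous (g x) := hg.comp (Continuous.prodMk_right x)
  set T := Matrix.toEuclideanCLM (n := Fin m) (𝕜 := ℝ) (G.chol c) with hT
  have hTdet : LinearMap.det (T : Eucl m →ₗ[ℝ] Eucl m) = (G.chol c).det := by
    rw [hT, Matrix.coe_toEuclideanCLM_eq_toEuclideanLin]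
    change LinearMap.det (Matrix.toLpLin 2 2 (G.chol c)) = _
    rw [Matrix.toLpLin_eq_toLin, LinearMap.det_toLin]
  have hset : MeasurableSet {z | g x z ≤ 0} := measurableSet_le hgx.measurable measurable_const
  set F : Eucl m → ℝ := fun z => {z | g x z ≤ 0}.indicator (G.density c) (z + G.mean c) with hF
  have hFm : Measurable F :=
    ((G.continuous_density c).measurable.indicator hset).comp (by fun_prop)
  have h1 : G.condProb g c x = ∫ z, F z := by
    rw [condProb, ← integral_indicator hset]
    exact (integral_add_right_eq_self _ (G.mean c)).symm
  have h2 : ∫ y, F (T y) = ((G.chol c).det)⁻¹ * ∫ z, F z := by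
    have hmap := Measure.map_linearMap_addHaar_eq_smul_addHaar (volume : Measure (Eucl m))
      (f := (T : Eucl m →ₗ[ℝ] Eucl m)) (by rw [hTdet]; exact hdet.ne')
    have h3 := integral_map (μ := (volume : Measure (Eucl m))) (φ := T)
      T.continuous.measurable.aemeasurable hFm.aestronglyMeasurable
    rw [← h3]
    have hmap' : Measure.map T (volume : Measure (Eucl m)) = _ := hmap
    rw [hmap', integral_smul_measure, hTdet, ENNReal.toReal_ofReal (abs_nonneg _),
      abs_of_pos (inv_pos.2 hdet), smul_eq_mul]
  have h3 : ∫ z, F z = (G.chol c).det * ∫ y, F (T y) := by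
    rw [h2]; field_simp
  rw [h1, h3, ← integral_const_mul]
  refine integral_congr_ae (Eventually.of_forall fun y => ?_)
  have hray : G.ray c y 1 = T y + G.mean c := by simp [ray, hT]
  simp only [hF]
  by_cases hy : g x (T y + G.mean c) ≤ 0
  · rw [Set.indicator_of_mem (by exact hy), Set.indicator_of_mem (by simpa [hray] using hy), hT,
      density_affine]
    field_simp
  · rw [Set.indicator_of_notMem (by exact hy), Set.indicator_of_notMem (by simpa [hray] using hy),
      mul_zero]

/-- The spheric-radial decomposition of the conditional probability function. -/
lemma condProb_eq_integral_radialProb (hm : 0 < m)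
    (hg : Continuous (fun q : Eucl n × Eucl m => g q.1 q.2)) (c : G.params)
    (x : Eucl n) : G.condProb g c x = ∫ v, G.radialProb g c x v ∂uniformSphere m := by
  have : Nonempty (Fin m) := ⟨⟨0, hm⟩⟩
  have hgx : Continuous (g x) := hg.comp (Continuous.prodMk_right x)
  set A : Set (Eucl m) := {y : Eucl m | g x (G.ray c y 1) ≤ 0} with hA
  have hAm : MeasurableSet A := by
    refine measurableSet_le (hgx.comp ?_).measurable measurable_const
    unfold ray; fun_prop
  set k : ℝ := 1 / √((2 * Real.pi) ^ m) with hk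
  set M := (volume : Measure (Eucl m)).toSphere Set.univ with hM
  have hMk := toSphere_real_univ_mul_gaussian hm
  have hM0 : M ≠ 0 := by
    rw [hM, ne_eq, Measure.measure_univ_eq_zero]
    exact Measure.toSphere_ne_zero _
  have hMr : M.toReal ≠ 0 := ENNReal.toReal_ne_zero.2 ⟨hM0, measure_ne_top _ _⟩
  have hχ : ∀ r : ℝ, M.toReal * (r ^ (m - 1) * (k * Real.exp (-r ^ 2 / 2))) = chiDensity m r := by
    intro r
    rw [chiDensity, ← hMk]; ring
  have hint : Integrable fun y : Eucl m => k * Real.exp (-‖y‖ ^ 2 / 2) := by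
    rw [integrable_fun_norm_addHaar (volume : Measure (Eucl m))
      (f := fun r => k * Real.exp (-r ^ 2 / 2)), finrank_euclideanSpace, Fintype.card_fin]
    have h := ((integrable_chiDensity m).const_mul M.toReal⁻¹).integrableOn (s := Set.Ioi 0)
    refine h.congr_fun (fun r _ => ?_) measurableSet_Ioi
    simp only [← hχ r, smul_eq_mul]
    field_simp
  rw [G.condProb_eq_integral hg, integral_eq_integral_toSphere _ (hint.indicator hAm),
    uniformSphere, integral_smul_measure, finrank_euclideanSpace, Fintype.card_fin,
    ENNReal.toReal_inv, smul_eq_mul, ← integral_const_mul]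
  refine integral_congr_ae (Eventually.of_forall fun v => ?_)
  have hc : Continuous fun r => g x (G.ray c v r) :=
    hg.comp (continuous_const.prodMk (G.continuous_ray c v))
  have hB : MeasurableSet {r | g x (G.ray c v r) ≤ 0} :=
    measurableSet_le hc.measurable measurable_const
  have hv : ‖(v : Eucl m)‖ = 1 := by simp
  simp only
  have e : {r : ℝ | 0 ≤ r ∧ g x (G.ray c v r) ≤ 0} = Set.Ici 0 ∩ {r | g x (G.ray c v r) ≤ 0} := rfl
  rw [radialProb_eq, e, ← setIntegral_indicator hB, integral_Ici_eq_integral_Ioi,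
    ← integral_const_mul]
  refine setIntegral_congr_fun measurableSet_Ioi fun r hr => ?_
  -- Homogeneity identifies the affine image of `r • v` with the ray point at radius `r`.
  have hray : G.ray c (r • (v : Eucl m)) 1 = G.ray c v r := by simp [ray]
  by_cases hr' : g x (G.ray c v r) ≤ 0
  · rw [Set.indicator_of_mem (by rw [hA, Set.mem_ofPred_eq, hray]; exact hr'),
      Set.indicator_of_mem (by exact hr'), ← hχ r, norm_smul, hv, mul_one, Real.norm_eq_abs, sq_abs,
      ← hM]
    field_simp
  · rw [Set.indicator_of_notMem (by rw [hA, Set.mem_ofPred_eq, hray]; exact hr'),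
      Set.indicator_of_notMem (by exact hr'), mul_zero, mul_zero]

end GaussianMixture

/-! ### Convergence in probability by coordinates. -/

section VectorConvergence

lemma tendstoInMeasure_euclidean {Ω : Type*} [MeasurableSpace Ω] {P : Measure Ω} {n : ℕ}
    {F : ℕ → Ω → Eucl n} {L : Ω → Eucl n}
    (h : ∀ i, TendstoInMeasure P (fun N ω => F N ω i) atTop fun ω => L ω i) :
    TendstoInMeasure P F atTop L := by
  simp only [tendstoInMeasure_iff_norm] at h ⊢
  intro ε hε
  -- Dividing by `n + 1` covers `n = 0` and makes the final comparison with `ε` strict.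
  have hε' : 0 < ε / (n + 1) := by positivity
  have hsum : Tendsto (fun N => ∑ i, P {ω | ε / (n + 1) ≤ ‖F N ω i - L ω i‖}) atTop (𝓝 0) := by
    simpa using tendsto_finsetSum Finset.univ fun i _ => h i _ hε'
  refine tendsto_of_tendsto_of_tendsto_of_le_of_le tendsto_const_nhds hsum (fun _ => zero_le)
    fun N => ?_
  refine (measure_mono fun ω hω => ?_).trans (measure_biUnion_finset_le Finset.univ _)
  simp only [Finset.mem_univ, Set.iUnion_true, Set.mem_iUnion, Set.mem_ofPred_eq]
  by_contra! hlt
  have h1 : ‖F N ω - L ω‖ ≤ ∑ i, ‖F N ω i - L ω i‖ := by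
    rw [EuclideanSpace.norm_eq]
    refine Real.sqrt_le_iff.2 ⟨Finset.sum_nonneg fun _ _ => norm_nonneg _, ?_⟩
    exact Finset.sum_sq_le_sq_sum_of_nonneg fun _ _ => norm_nonneg _
  have h2 : ∑ i, ‖F N ω i - L ω i‖ ≤ n * (ε / (n + 1)) := by
    refine (Finset.sum_le_sum fun i _ => (hlt i).le).trans (by simp)
  have h3 : n * (ε / (n + 1)) < ε := by
    rw [mul_div_assoc', div_lt_iff₀ (by positivity)]
    nlinarith
  have h4 : ε ≤ ‖F N ω - L ω‖ := hω
  linarith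

end VectorConvergence

/-! ### Differentiation under the integral. -/

namespace GaussianMixture

variable {m n p : ℕ} (G : GaussianMixture m p) {g : Eucl n → Eucl m → ℝ}

instance : IsProbabilityMeasure G.prior := G.isProbabilityMeasure_prior

instance [NeZero m] : IsProbabilityMeasure G.samplingLaw := by
  unfold samplingLaw; infer_instance

lemma integrable_radialProb [NeZero m] (hg : Continuous (fun q : Eucl n × Eucl m => g q.1 q.2))
    (x : Eucl n) :
    Integrable (fun q : USphere m × G.params => G.radialProb g q.2 x q.1) G.samplingLaw :=
  Integrable.of_bound (G.measurable_radialProb hg x).aestronglyMeasurable _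
    (Eventually.of_forall fun q => G.abs_radialProb_le hg q.2 x q.1)

lemma probFun_eq_integral [NeZero m] (hg : Continuous (fun q : Eucl n × Eucl m => g q.1 q.2))
    (x : Eucl n) :
    G.probFun g x = ∫ q, G.radialProb g q.2 x q.1 ∂G.samplingLaw := by
  have h := G.integrable_radialProb hg x
  unfold samplingLaw at h ⊢
  rw [integral_prod_symm _ h, probFun]
  exact integral_congr_ae (Eventually.of_forall fun c =>
    G.condProb_eq_integral_radialProb (NeZero.pos m) hg c x)

lemma gradient_apply_eq_fderiv {F : Eucl n → ℝ} (x : Eucl n) (i : Fin n) :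
    (∇ F x) i = fderiv ℝ F x (EuclideanSpace.single i 1) := by
  rw [← toDual_gradient, InnerProductSpace.toDual_apply_apply]
  rw [EuclideanSpace.inner_single_right, one_mul, conj_trivial]

/-- Each coordinate is a pointwise limit of difference quotients with step `1 / k`, which are
measurable in direction and parameter. -/
lemma measurable_gradient_radialProb (hg : Continuous (fun q : Eucl n × Eucl m => g q.1 q.2))
    {x₀ : Eucl n}
    (hdiff : ∀ c (v : USphere m), DifferentiableAt ℝ (fun y => G.radialProb g c y v) x₀) :
    Measurable fun q : USphere m × G.params => ∇ (fun y => G.radialProb g q.2 y q.1) x₀ := by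
  refine (MeasurableEquiv.toLp 2 (Fin n → ℝ)).measurable.comp
    (f := fun q : USphere m × G.params => (∇ (fun y => G.radialProb g q.2 y q.1) x₀).ofLp)
    (measurable_pi_lambda _ fun i => ?_)
  simp only [gradient_apply_eq_fderiv]
  refine measurable_of_tendsto_metrizable (f := fun (k : ℕ) (q : USphere m × G.params) =>
    (k : ℝ) • (G.radialProb g q.2 (x₀ + (k : ℝ)⁻¹ • EuclideanSpace.single i (1 : ℝ)) q.1 -
      G.radialProb g q.2 x₀ q.1)) (fun k => ?_) (tendsto_pi_nhds.2 fun q => ?_)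
  · simp only [smul_eq_mul]
    exact ((G.measurable_radialProb hg _).sub (G.measurable_radialProb hg _)).const_mul _
  · exact ((hdiff q.2 q.1).hasFDerivAt.lim_real (EuclideanSpace.single i (1 : ℝ))).comp
      tendsto_natCast_atTop_atTop

lemma exists_norm_gradient_radialProb_le
    (hg : ContDiff ℝ 1 (fun q : Eucl n × Eucl m => g q.1 q.2))
    (hconv : ∀ x, ConvexOn ℝ Set.univ (g x)) {x₀ : Eucl n} (hS : G.IsUniformSlaterPoint g x₀)
    (hexp : ExponentialGrowthAt g x₀) :
    ∃ C : ℝ, ∀ c (v : USphere m), ‖∇ (fun y => G.radialProb g c y v) x₀‖ ≤ C := by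
  obtain ⟨δ, C, hδ, hC, hlip⟩ := G.exists_forall_abs_radialProb_sub_le hg hconv hS hexp
  refine ⟨C, fun c v => ?_⟩
  rw [← norm_fderiv_eq_norm_gradient]
  refine (G.differentiableAt_radialProb hg hconv hS hexp c v).hasFDerivAt.le_of_lip' hC ?_
  filter_upwards [Metric.ball_mem_nhds x₀ hδ] with y hy
  exact hlip y hy c v

/-- Dominated differentiation needs only increments from `x₀`, which the uniform Lipschitz constant
bounds. -/
lemma hasGradientAt_probFun [NeZero m]
    (hg : ContDiff ℝ 1 (fun q : Eucl n × Eucl m => g q.1 q.2))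
    (hconv : ∀ x, ConvexOn ℝ Set.univ (g x)) {x₀ : Eucl n} (hS : G.IsUniformSlaterPoint g x₀)
    (hexp : ExponentialGrowthAt g x₀) :
    HasGradientAt (G.probFun g)
      (∫ q, ∇ (fun y => G.radialProb g q.2 y q.1) x₀ ∂G.samplingLaw) x₀ := by
  have hdiff := G.differentiableAt_radialProb hg hconv hS hexp
  have hgm := (G.measurable_gradient_radialProb hg.continuous hdiff).stronglyMeasurable
  obtain ⟨δ, C, hδ, hC, hlip⟩ := G.exists_forall_abs_radialProb_sub_le hg hconv hS hexp
  have h := hasFDerivAt_integral_of_dominated_loc_of_lip' (μ := G.samplingLaw) (𝕜 := ℝ)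
    (F := fun y (q : USphere m × G.params) => G.radialProb g q.2 y q.1)
    (F' := fun q => InnerProductSpace.toDual ℝ (Eucl n) (∇ (fun y => G.radialProb g q.2 y q.1) x₀))
    (bound := fun _ => C) (Metric.ball_mem_nhds x₀ hδ)
    (fun y _ => (G.measurable_radialProb hg.continuous y).aestronglyMeasurable)
    (G.integrable_radialProb hg.continuous x₀)
    ((InnerProductSpace.toDual ℝ (Eucl n)).continuous.comp_stronglyMeasurable
      hgm).aestronglyMeasurable
    (Eventually.of_forall fun q y hy => hlip y hy q.2 q.1) (integrable_const C)
    (Eventually.of_forall fun q => by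
      rw [toDual_gradient]
      exact (hdiff q.2 q.1).hasFDerivAt)
  have hΦ : G.probFun g = fun y => ∫ q, G.radialProb g q.2 y q.1 ∂G.samplingLaw :=
    funext fun y => G.probFun_eq_integral hg.continuous y
  rw [hasGradientAt_iff_hasFDerivAt, hΦ]
  obtain ⟨C', hC'⟩ := G.exists_norm_gradient_radialProb_le hg hconv hS hexp
  have hint : Integrable (fun q : USphere m × G.params =>
      ∇ (fun y => G.radialProb g q.2 y q.1) x₀) G.samplingLaw :=
    Integrable.of_bound hgm.aestronglyMeasurable C' (Eventually.of_forall fun q => hC' q.2 q.1)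
  have heq : InnerProductSpace.toDual ℝ (Eucl n)
      (∫ q, ∇ (fun y => G.radialProb g q.2 y q.1) x₀ ∂G.samplingLaw) =
      ∫ q, InnerProductSpace.toDual ℝ (Eucl n) (∇ (fun y => G.radialProb g q.2 y q.1) x₀)
        ∂G.samplingLaw := by
    refine DFunLike.ext _ _ fun u => ?_
    rw [ContinuousLinearMap.integral_apply h.1]
    simp only [InnerProductSpace.toDual_apply_apply]
    rw [real_inner_comm, ← integral_inner hint]
    exact integral_congr_ae (Eventually.of_forall fun q => real_inner_comm _ _)
  rw [heq]
  exact h.2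

end GaussianMixture

end

theorem corollary2 {m n p : ℕ} (hm : 0 < m)
    (G : GaussianMixture m p)
    (g : Eucl n → Eucl m → ℝ)
    (hg : ContDiff ℝ 1 (fun q : Eucl n × Eucl m => g q.1 q.2))
    (hconv : ∀ x, ConvexOn ℝ Set.univ (g x))
    (X : Set (Eucl n)) (hX : IsCompact X)
    (hSlater : ∀ x ∈ X, G.IsUniformSlaterPoint g x)
    (hgrowth : ∀ x ∈ X, ExponentialGrowthAt g x)
    {Ω : Type*} [MeasurableSpace Ω] (P : Measure Ω) [IsProbabilityMeasure P]
    (Y : ℕ → Ω → USphere m × G.params)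
    (hY : IsIIDSample P Y G.samplingLaw ∨ IsMCMCSample P Y G.samplingLaw) :
    ∀ x ∈ X,
      (∀ (c : G.params) (v : USphere m), DifferentiableAt ℝ (fun y => G.radialProb g c y v) x) ∧
      DifferentiableAt ℝ (G.probFun g) x ∧
      TendstoInMeasure P (fun N ω => G.empProb g (fun i => Y i ω) N x) atTop
        (fun _ => G.probFun g x) ∧
      TendstoInMeasure P (fun N ω => G.empGrad g (fun i => Y i ω) N x) atTop
        (fun _ => ∇ (G.probFun g) x) := by
  intro x hx
  have : NeZero m := ⟨hm.ne'⟩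
  have hdiff := G.differentiableAt_radialProb hg hconv (hSlater x hx) (hgrowth x hx)
  have hgrad := G.hasGradientAt_probFun hg hconv (hSlater x hx) (hgrowth x hx)
  have hgm := G.measurable_gradient_radialProb hg.continuous hdiff
  obtain ⟨C, hC⟩ := G.exists_norm_gradient_radialProb_le hg hconv (hSlater x hx) (hgrowth x hx)
  -- The sampling scheme enters only through this law for bounded measurable functions.
  have hLLN : ∀ {f : USphere m × G.params → ℝ} {C : ℝ}, Measurable f → (∀ q, |f q| ≤ C) →
      TendstoInMeasure P (fun (N : ℕ) ω => (N : ℝ)⁻¹ * ∑ i ∈ Finset.range N, f (Y i ω)) atTop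
        (fun _ => ∫ q, f q ∂G.samplingLaw) := fun hf hC =>
    hY.elim (fun h => h.tendstoInMeasure_average hf hC) fun h => h.tendstoInMeasure_average hf hC
  refine ⟨hdiff, hgrad.hasFDerivAt.differentiableAt, ?_, ?_⟩
  · rw [G.probFun_eq_integral hg.continuous]
    exact hLLN (f := fun q => G.radialProb g q.2 x q.1) (G.measurable_radialProb hg.continuous x)
      fun q => G.abs_radialProb_le hg.continuous q.2 x q.1
  · refine tendstoInMeasure_euclidean fun i => ?_
    have hint : Integrable (fun q : USphere m × G.params =>
        ∇ (fun y => G.radialProb g q.2 y q.1) x) G.samplingLaw :=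
      Integrable.of_bound hgm.aestronglyMeasurable C (Eventually.of_forall fun q => hC q.2 q.1)
    have hi : (∇ (G.probFun g) x) i =
        ∫ q, (∇ (fun y => G.radialProb g q.2 y q.1) x) i ∂G.samplingLaw := by
      rw [hgrad.gradient]
      exact ((EuclideanSpace.proj (𝕜 := ℝ) i).integral_comp_comm hint).symm
    have h := hLLN (f := fun q => (∇ (fun y => G.radialProb g q.2 y q.1) x) i) (C := C)
      (by fun_prop) fun q => (PiLp.norm_apply_le _ i).trans (hC q.2 q.1)
    rw [hi]
    refine h.congr_left fun N => Eventually.of_forall fun ω => ?_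
    simp [GaussianMixture.empGrad]
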